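/- Let $\mathbb{F}$ be a finite field with $q$ elements, let $E/\mathbb{F}$ be an elliptic curve given by a Weierstrass equation $y^2+a_1xy+a_3y=x^3+a_2x^2+a_4x+a_6$ with point at infinity $\mathcal{O}$, and let $z=-x/y$ be the usual uniformizer at $\mathcal{O}$. For $n\ge 1$ let $F_n\in\mathbb{F}(E)$ be the normalized $n$-division polynomial, i.e. the unique function with divisor $[n]^*(\mathcal{O})-n^2(\mathcal{O})$ for which the function $z^{n^2}F_n/(z\circ[n])$ takes the value $1$ at $\mathcal{O}$ (the expansion of $z\circ[n]$ at $\mathcal{O}$ in powers of $z$ is the multiplication-by-$n$ series $[n](z)$ of the formal group of $E$); put $F_0=0$. Let $P\in E(\mathbb{F})$ be a point of exact order $r\ge 2$. Then the sequence $(F_n(P))_{n\ge 0}$ is purely periodic, and its least period is $rt$ for some integer $t\ge 1$, where $t$ divides $q-1$ if $r\ge 3$, and $t$ divides $2q-2$ if $r=2$. -/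

import Mathlib

open Polynomial
open scoped Polynomial.Bivariate

noncomputable section

namespace DivisionPolynomial

open WeierstrassCurve

/-- The coordinate function `x` in the function field `K(E)`. -/
def xFun {K : Type*} [Field K] (W : Affine K) : W.FunctionField :=
  algebraMap W.CoordinateRing W.FunctionField (Affine.CoordinateRing.mk W (C X))

/-- The coordinate function `y` in the function field `K(E)`. -/
def yFun {K : Type*} [Field K] (W : Affine K) : W.FunctionField :=
  algebraMap W.CoordinateRing W.FunctionField (Affine.CoordinateRing.mk W Y)

/-- The uniformizer `z = -x/y` at the point at infinity `𝓞`. -/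
def zFun {K : Type*} [Field K] (W : Affine K) : W.FunctionField :=
  -(xFun W / yFun W)

/-- The function `w = -1/y`; in the coordinates `(z, w)`, the point at infinity is `(0, 0)`. -/
def wFun {K : Type*} [Field K] (W : Affine K) : W.FunctionField :=
  -(1 / yFun W)

/-- Let `u, v` be the two coordinate functions of an affine chart of `E`, in which a point has
coordinates `(u₀, v₀)` with values in an extension `L` of `K`. The function `f ∈ K(E)` is regular at
the point, with value `c`: it is a quotient `G(u, v) / H(u, v)` with `G, H ∈ K[U, V]`,
`H(u₀, v₀) ≠ 0` and `c = G(u₀, v₀) / H(u₀, v₀)`. -/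
def HasChartValue {K L : Type*} [Field K] [Field L] [Algebra K L] {W : Affine K}
    (u v : W.FunctionField) (u₀ v₀ : L) (f : W.FunctionField) (c : L) : Prop :=
  ∃ G H : K[X][Y], aevalAeval u₀ v₀ H ≠ 0 ∧
    f = aevalAeval u v G / aevalAeval u v H ∧ c = aevalAeval u₀ v₀ G / aevalAeval u₀ v₀ H

/-- The function `f ∈ K(E)` is regular at the point `Q ∈ E(L)`, with value `c`. Affine points are
considered in the chart `(x, y)`, the point at infinity in the chart `(z, w)`. -/
def HasValueAt {K L : Type*} [Field K] [Field L] [Algebra K L] (W : Affine K)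
    (f : W.FunctionField) (c : L) : (W.baseChange L).Point → Prop
  | .zero => HasChartValue (zFun W) (wFun W) 0 0 f c
  | .some x₀ y₀ _ => HasChartValue (xFun W) (yFun W) x₀ y₀ f c

lemma equation_xFun_yFun {K : Type*} [Field K] (W : Affine K) :
    (W.baseChange W.FunctionField).Equation (xFun W) (yFun W) := by
  have h : algebraMap W.CoordinateRing W.FunctionField
      (Affine.CoordinateRing.mk W W.polynomial) = 0 := by
    rw [AdjoinRoot.mk_self, map_zero]
  have hC : ∀ a : K, algebraMap W.CoordinateRing W.FunctionField
      (Affine.CoordinateRing.mk W (C (C a))) = algebraMap K W.FunctionField a := fun a => rfl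
  rw [Affine.equation_iff']
  simp only [Affine.polynomial, map_add, map_sub, map_mul, map_pow, hC] at h
  change yFun W ^ 2 + algebraMap K W.FunctionField W.a₁ * xFun W * yFun W +
    algebraMap K W.FunctionField W.a₃ * yFun W - (xFun W ^ 3 +
    algebraMap K W.FunctionField W.a₂ * xFun W ^ 2 +
    algebraMap K W.FunctionField W.a₄ * xFun W + algebraMap K W.FunctionField W.a₆) = 0
  rw [← h, xFun, yFun]
  ring

/-- The generic point `(x, y)` of `E`, as a point of `E(K(E))`. -/
def genericPoint {K : Type*} [Field K] (W : Affine K) [W.IsElliptic] :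
    (W.baseChange W.FunctionField).Point :=
  haveI : (W.baseChange W.FunctionField).IsElliptic :=
    inferInstanceAs (WeierstrassCurve.map W (algebraMap K W.FunctionField)).IsElliptic
  .some (xFun W) (yFun W) (Affine.equation_iff_nonsingular.mp (equation_xFun_yFun W))

/-- The value of `z = -x/y` at an affine point (with the dummy value `0` at infinity). -/
def zCoord {L : Type*} [Field L] {V : Affine L} : V.Point → L
  | .zero => 0
  | .some x y _ => -(x / y)

open Classical in
/-- The function `[n]^* z = z ∘ [n] ∈ K(E)`, that is, `z` evaluated at the `n`-th multiple of the
generic point. Its expansion at `𝓞` in powers of `z` is the power series `[n](z)` of the formal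
group of `E`. -/
def zMul {K : Type*} [Field K] (W : Affine K) [W.IsElliptic] (n : ℕ) : W.FunctionField :=
  zCoord (n • genericPoint W)

open Classical in
/-- A local equation of the divisor `[n]^*(𝓞) - n²(𝓞)` near the geometric point `Q`. Near `𝓞` the
divisor `(𝓞)` has local equation `z`, and elsewhere it has local equation `1`; so `[n]^*(𝓞)` has
local equation `z ∘ [n]` near the points of `E[n]`, and `1` elsewhere. -/
def localEquation {K : Type*} [Field K] (W : Affine K) [W.IsElliptic] (n : ℕ)
    (Q : (W.baseChange (AlgebraicClosure K)).Point) : W.FunctionField :=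
  (if n • Q = 0 then zMul W n else 1) / (if Q = 0 then zFun W else 1) ^ n ^ 2

/-- `F ∈ K(E)` is the `n`-division polynomial of `E` normalized relative to the uniformizer `z`:
its divisor is `[n]^*(𝓞) - n²(𝓞)`, and `z ^ n² * F / [n](z)` takes the value `1` at `𝓞`. -/
structure IsDivisionPolynomial {K : Type*} [Field K] (W : Affine K) [W.IsElliptic] (n : ℕ)
    (F : W.FunctionField) : Prop where
  /-- At every geometric point `Q`, the quotient of `F` by a local equation of
  `[n]^*(𝓞) - n²(𝓞)` is a unit of the local ring. -/
  divisor : ∀ Q : (W.baseChange (AlgebraicClosure K)).Point,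
    ∃ c : AlgebraicClosure K, c ≠ 0 ∧ HasValueAt W (F / localEquation W n Q) c Q
  normalized : HasValueAt W (zFun W ^ n ^ 2 * F / zMul W n) (1 : K) .zero

/-- The `n`-division polynomial `F_n ∈ K(E)`: the unique function satisfying
`IsDivisionPolynomial` if `n ≥ 1`, with the convention `F_0 = 0`. -/
def divisionPolynomial {K : Type*} [Field K] (W : Affine K) [W.IsElliptic] (n : ℕ) :
    W.FunctionField :=
  if n = 0 then 0 else Classical.epsilon (IsDivisionPolynomial W n)

/-- The value `f(P) ∈ K` of a function `f ∈ K(E)` at a point `P ∈ E(K)` where `f` is regular. -/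
def valueAt {K : Type*} [Field K] (W : Affine K) (f : W.FunctionField) : W.Point → K
  | .zero => Classical.epsilon fun c : K => HasChartValue (zFun W) (wFun W) 0 0 f c
  | .some x₀ y₀ _ => Classical.epsilon fun c : K => HasChartValue (xFun W) (yFun W) x₀ y₀ f c

/-- The least period of a purely periodic sequence `s` is `l`: `l` is the least positive integer
with `s (n + l) = s n` for all `n ≥ 0`. -/
def HasLeastPeriod {α : Type*} (s : ℕ → α) (l : ℕ) : Prop :=
  IsLeast {l : ℕ | 0 < l ∧ ∀ n, s (n + l) = s n} l

end DivisionPolynomial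

end

/-! The engine is the identity `F_{n+1} F_{n-1} = F_n² (x - x∘[n])`, the algebraic form of `σ(A+B)
σ(B-A) = σ(A)² σ(B)² (x(A) - x(B))` with `A` the generic point and `B` its `n`-th multiple. Here it
serves as the definition of `divFun`, starting from `1` and `-2y - a₁x - a₃`.

Local analysis (`chord`, `tangent`): divide each function by a local equation of its expected
divisor. Wherever `A`, `B` reduce to points `A'`, `B'`, the normalized difference of `x`-coordinates
is a unit whose value `chordValue A' B'` depends only on `A'` and `B'`. By induction every
normalized `divFun` is a unit at every point, with value `1` at `𝓞` (`divFunRegularAt`). So `divFun`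
has the required divisor and normalization; since functions without affine zeros and poles are
constant, it is the division polynomial (`divisionPolynomial_eq_divFun`).

Arithmetic: let `P` have order `r`, let `ε_n ≠ 0` be the normalized value of `F_{n+1}` at `P`, and
let `u_i = chordValue P (iP)`, which is `r`-periodic in `i`. Then `ε_{n+2} ε_n = ε_{n+1}² u_{n+2}`,
so the ratios `ε_{n+1}/ε_n` are multiplied by `U = u_0 ⋯ u_{r-1}` over each period, and `ε_{n+rk} =
ε_n (ε_{n+r}/ε_n)^k (U^r)^{k(k-1)/2}`. For `k = q - 1` the middle factor is `1` by Fermat, and so is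
the last one because `U^r` is a square: trivially for even `r`, and by the symmetry `i ↦ r - i` for
odd `r` (`isSquare_prod_chordValue`). Hence `r(q-1)` is a period. The sequence vanishes exactly at
the multiples of `r`, so `r` divides the least period `rt`, and `t ∣ q - 1`, even when `r = 2`. -/

namespace DivisionPolynomial

open WeierstrassCurve

/-! ### Abstract evaluation at a point: the calculus of regular functions and their values -/

section ValueRel

/-- An abstract evaluation of the elements of a field `F` at a point with values in `L`, given as a
relation: `v.HasValue f c` says that `f` is regular at the point, with value `c`. -/
structure ValueRel (K F L : Type*) [Field K] [Field F] [Field L] [Algebra K F] [Algebra K L] where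
  /-- `f` is regular with value `c`. -/
  HasValue : F → L → Prop
  const : ∀ a : K, HasValue (algebraMap K F a) (algebraMap K L a)
  add : ∀ {f g c d}, HasValue f c → HasValue g d → HasValue (f + g) (c + d)
  mul : ∀ {f g c d}, HasValue f c → HasValue g d → HasValue (f * g) (c * d)
  inv : ∀ {f c}, HasValue f c → c ≠ 0 → HasValue f⁻¹ c⁻¹
  eq_zero : ∀ {c}, HasValue 0 c → c = 0

namespace ValueRel

variable {K F L : Type*} [Field K] [Field F] [Field L] [Algebra K F] [Algebra K L]
  (v : ValueRel K F L) {f g : F} {c d : L}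

lemma zero : v.HasValue 0 0 := by simpa using v.const 0

lemma one : v.HasValue 1 1 := by simpa using v.const 1

lemma ofNat (n : ℕ) [n.AtLeastTwo] : v.HasValue (OfNat.ofNat n) (OfNat.ofNat n) := by
  simpa only [map_ofNat] using v.const (OfNat.ofNat n)

variable {v}

namespace HasValue

lemma add (hf : v.HasValue f c) (hg : v.HasValue g d) : v.HasValue (f + g) (c + d) :=
  v.add hf hg

lemma mul (hf : v.HasValue f c) (hg : v.HasValue g d) : v.HasValue (f * g) (c * d) :=
  v.mul hf hg

lemma neg (hf : v.HasValue f c) : v.HasValue (-f) (-c) := by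
  simpa using v.mul (v.const (-1)) hf

lemma sub (hf : v.HasValue f c) (hg : v.HasValue g d) : v.HasValue (f - g) (c - d) := by
  simpa [sub_eq_add_neg] using v.add hf hg.neg

lemma div (hf : v.HasValue f c) (hg : v.HasValue g d) (hd : d ≠ 0) :
    v.HasValue (f / g) (c / d) := by
  simpa [div_eq_mul_inv] using v.mul hf (v.inv hg hd)

lemma pow (hf : v.HasValue f c) (n : ℕ) : v.HasValue (f ^ n) (c ^ n) := by
  induction n with
  | zero => simpa using v.one
  | succ n ih => simpa [pow_succ] using v.mul ih hf

lemma unique (hf : v.HasValue f c) (hf' : v.HasValue f d) : c = d :=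
  sub_eq_zero.mp <| v.eq_zero <| by simpa using hf.sub hf'

lemma ne_zero (hf : v.HasValue f c) (hc : c ≠ 0) : f ≠ 0 := by
  rintro rfl
  exact hc (v.eq_zero hf)

lemma congr (hf : v.HasValue f c) (hfg : f = g) (hcd : c = d) : v.HasValue g d := hfg ▸ hcd ▸ hf

end HasValue

end ValueRel

end ValueRel

/-! ### Evaluation in an affine chart -/

section Chart

variable {K L : Type*} [Field K] [Field L] [Algebra K L] {W : Affine K}

/-- The evaluation at a point of an affine chart of a curve. -/
def chartRel (u v : W.FunctionField) (u₀ v₀ : L)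
    (h : ∀ H : K[X][Y], aevalAeval u v H = 0 → aevalAeval u₀ v₀ H = 0) :
    ValueRel K W.FunctionField L where
  HasValue := HasChartValue u v u₀ v₀
  const a := ⟨C (C a), 1, by simp, by simp, by simp⟩
  add := by
    rintro f g c d ⟨G, H, hH, rfl, rfl⟩ ⟨G', H', hH', rfl, rfl⟩
    refine ⟨G * H' + H * G', H * H', by rw [map_mul]; exact mul_ne_zero hH hH', ?_, ?_⟩
    · simp only [map_add, map_mul]
      rw [div_add_div _ _ (mt (h H) hH) (mt (h H') hH')]
    · simp only [map_add, map_mul]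
      rw [div_add_div _ _ hH hH']
  mul := by
    rintro f g c d ⟨G, H, hH, rfl, rfl⟩ ⟨G', H', hH', rfl, rfl⟩
    exact ⟨G * G', H * H', by rw [map_mul]; exact mul_ne_zero hH hH',
      by simp [div_mul_div_comm],
      by simp [div_mul_div_comm]⟩
  inv := by
    rintro f c ⟨G, H, hH, rfl, rfl⟩ hc
    exact ⟨H, G, (div_ne_zero_iff.mp hc).1, by simp, by simp⟩
  eq_zero := by
    rintro c ⟨G, H, hH, h₀, rfl⟩
    rw [eq_comm, div_eq_zero_iff, or_iff_left (mt (h H) hH)] at h₀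
    rw [h G h₀, zero_div]

lemma chartRel_fst (u v : W.FunctionField) (u₀ v₀ : L) : HasChartValue u v u₀ v₀ u u₀ :=
  ⟨C X, 1, by simp, by simp, by simp⟩

lemma chartRel_snd (u v : W.FunctionField) (u₀ v₀ : L) : HasChartValue u v u₀ v₀ v v₀ :=
  ⟨Y, 1, by simp, by simp, by simp⟩

lemma aevalAeval_xFun_yFun (H : K[X][Y]) : aevalAeval (xFun W) (yFun W) H =
    algebraMap W.CoordinateRing W.FunctionField (Affine.CoordinateRing.mk W H) := by
  let φ : K[X][Y] →ₐ[K] W.FunctionField :=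
    { (algebraMap W.CoordinateRing W.FunctionField).comp (Affine.CoordinateRing.mk W) with
      commutes' := fun a => rfl }
  change _ = φ H
  congr 1
  apply (aevalAevalEquiv K W.FunctionField).symm.injective
  rw [Equiv.symm_apply_apply]
  rfl

lemma aevalAeval_polynomial (x y : L) :
    aevalAeval x y W.polynomial = y ^ 2 + algebraMap K L W.a₁ * x * y + algebraMap K L W.a₃ * y -
      (x ^ 3 + algebraMap K L W.a₂ * x ^ 2 + algebraMap K L W.a₄ * x + algebraMap K L W.a₆) := by
  simp [Affine.polynomial]
  ring

lemma aevalAeval_polynomial_eq_zero {x y : L} (h : (W.baseChange L).Equation x y) :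
    aevalAeval x y W.polynomial = 0 := by
  rw [aevalAeval_polynomial]
  exact (Affine.equation_iff' ..).mp h

/-- The relations between `x` and `y` are the multiples of the Weierstrass polynomial, which
vanishes at every point of the curve. Hence values in the chart `(x, y)` are well defined. -/
lemma aevalAeval_eq_zero_of_equation {x y : L} (h : (W.baseChange L).Equation x y) (H : K[X][Y])
    (hH : aevalAeval (xFun W) (yFun W) H = 0) : aevalAeval x y H = 0 := by
  rw [aevalAeval_xFun_yFun, map_eq_zero_iff _ (IsFractionRing.injective _ _),
    AdjoinRoot.mk_eq_zero] at hH
  obtain ⟨G, rfl⟩ := hH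
  rw [map_mul, aevalAeval_polynomial_eq_zero h, zero_mul]

end Chart

/-! ### Pole orders at infinity and evaluation at `𝓞` -/

section Infinity

variable {K : Type*} [Field K] (W : Affine K)

/-- The order of the pole at infinity of an element of the coordinate ring. -/
noncomputable def poleDegree (a : W.CoordinateRing) : WithBot ℕ := (Algebra.norm K[X] a).degree

variable {W}

lemma poleDegree_mul (a b : W.CoordinateRing) :
    poleDegree W (a * b) = poleDegree W a + poleDegree W b := by
  simp [poleDegree]

lemma poleDegree_smul_basis (p q : K[X]) :
    poleDegree W (p • 1 + q • Affine.CoordinateRing.mk W Y) =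
      max (2 • p.degree) (2 • q.degree + 3) :=
  Affine.CoordinateRing.degree_norm_smul_basis p q

/-- The norm is multiplicative but its behaviour under sums is not visible; the ultrametric
inequality is read off from the coordinates in the basis `1, y`. -/
lemma poleDegree_add_le (a b : W.CoordinateRing) :
    poleDegree W (a + b) ≤ max (poleDegree W a) (poleDegree W b) := by
  obtain ⟨p, q, rfl⟩ := Affine.CoordinateRing.exists_smul_basis_eq a
  obtain ⟨p', q', rfl⟩ := Affine.CoordinateRing.exists_smul_basis_eq b
  have : p • (1 : W.CoordinateRing) + q • Affine.CoordinateRing.mk W Y +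
      (p' • 1 + q' • Affine.CoordinateRing.mk W Y) =
      (p + p') • 1 + (q + q') • Affine.CoordinateRing.mk W Y := by
    simp only [add_smul]; abel
  rw [this]
  simp only [poleDegree_smul_basis]
  have hp := degree_add_le p p'
  have hq := degree_add_le q q'
  have key : ∀ x y z : WithBot ℕ, x ≤ max y z → 2 • x ≤ max (2 • y) (2 • z) := fun x y z h => by
    rcases le_max_iff.mp h with h | h
    · exact le_max_of_le_left (nsmul_le_nsmul_right h 2)
    · exact le_max_of_le_right (nsmul_le_nsmul_right h 2)
  refine max_le ?_ ?_
  · exact (key _ _ _ hp).trans (max_le (by simp) (by simp))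
  · refine (add_le_add_left (key _ _ _ hq) 3).trans ?_
    rw [max_add]
    exact max_le (by simp) (by simp)

lemma poleDegree_eq_bot {a : W.CoordinateRing} : poleDegree W a = ⊥ ↔ a = 0 := by
  rw [poleDegree, degree_eq_bot,
    Algebra.norm_eq_zero_iff_of_basis (Affine.CoordinateRing.basis W)]

lemma poleDegree_x : poleDegree W (Affine.CoordinateRing.mk W (C X)) = 2 := by
  have := poleDegree_smul_basis (W := W) X 0
  simp only [zero_smul, add_zero, degree_zero, degree_X, Affine.CoordinateRing.smul,
    mul_one] at this
  rw [this]
  rfl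

lemma poleDegree_y : poleDegree W (Affine.CoordinateRing.mk W Y) = 3 := by
  have := poleDegree_smul_basis (W := W) 0 1
  simp only [zero_smul, zero_add, degree_zero, degree_one, one_smul] at this
  rw [this]
  simp

lemma poleDegree_one : poleDegree W 1 = 0 := by simp [poleDegree]

lemma poleDegree_C {c : K} (hc : c ≠ 0) :
    poleDegree W (Affine.CoordinateRing.mk W (C (C c))) = 0 := by
  have := poleDegree_smul_basis (W := W) (C c) 0
  simp only [zero_smul, add_zero, degree_zero, degree_C hc, Affine.CoordinateRing.smul,
    mul_one] at this
  rw [this]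
  simp

/-- The functions without a pole at infinity. -/
def IsBoundedAtInfinity (f : W.FunctionField) : Prop :=
  ∃ a b : W.CoordinateRing, b ≠ 0 ∧ f = algebraMap _ _ a / algebraMap _ _ b ∧
    poleDegree W a ≤ poleDegree W b

/-- The functions with a zero at infinity. -/
def IsZeroAtInfinity (f : W.FunctionField) : Prop :=
  ∃ a b : W.CoordinateRing, b ≠ 0 ∧ f = algebraMap _ _ a / algebraMap _ _ b ∧
    poleDegree W a < poleDegree W b

lemma IsBoundedAtInfinity.add {f g : W.FunctionField} (hf : IsBoundedAtInfinity f)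
    (hg : IsBoundedAtInfinity g) : IsBoundedAtInfinity (f + g) := by
  obtain ⟨a, b, hb, rfl, h⟩ := hf
  obtain ⟨a', b', hb', rfl, h'⟩ := hg
  refine ⟨a * b' + b * a', b * b', mul_ne_zero hb hb', ?_, ?_⟩
  · rw [div_add_div _ _ (by simpa using hb) (by simpa using hb')]
    simp
  · refine (poleDegree_add_le _ _).trans (max_le ?_ ?_) <;> rw [poleDegree_mul, poleDegree_mul]
    · exact add_le_add_left h _
    · exact add_le_add_right h' _

lemma IsZeroAtInfinity.add {f g : W.FunctionField} (hf : IsZeroAtInfinity f)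
    (hg : IsZeroAtInfinity g) : IsZeroAtInfinity (f + g) := by
  obtain ⟨a, b, hb, rfl, h⟩ := hf
  obtain ⟨a', b', hb', rfl, h'⟩ := hg
  refine ⟨a * b' + b * a', b * b', mul_ne_zero hb hb', ?_, ?_⟩
  · rw [div_add_div _ _ (by simpa using hb) (by simpa using hb')]
    simp
  · refine (poleDegree_add_le _ _).trans_lt (max_lt ?_ ?_) <;> rw [poleDegree_mul, poleDegree_mul]
    · exact WithBot.add_lt_add_right (poleDegree_eq_bot.not.mpr hb') h
    · exact WithBot.add_lt_add_left (poleDegree_eq_bot.not.mpr hb) h'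

lemma IsZeroAtInfinity.isBoundedAtInfinity {f : W.FunctionField} (hf : IsZeroAtInfinity f) :
    IsBoundedAtInfinity f := by
  obtain ⟨a, b, hb, rfl, h⟩ := hf
  exact ⟨a, b, hb, rfl, h.le⟩

lemma IsBoundedAtInfinity.mul {f g : W.FunctionField} (hf : IsBoundedAtInfinity f)
    (hg : IsBoundedAtInfinity g) : IsBoundedAtInfinity (f * g) := by
  obtain ⟨a, b, hb, rfl, h⟩ := hf
  obtain ⟨a', b', hb', rfl, h'⟩ := hg
  refine ⟨a * a', b * b', mul_ne_zero hb hb', by simp [div_mul_div_comm], ?_⟩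
  rw [poleDegree_mul, poleDegree_mul]
  exact add_le_add h h'

lemma IsZeroAtInfinity.mul {f g : W.FunctionField} (hf : IsZeroAtInfinity f)
    (hg : IsBoundedAtInfinity g) : IsZeroAtInfinity (f * g) := by
  obtain ⟨a, b, hb, rfl, h⟩ := hf
  obtain ⟨a', b', hb', rfl, h'⟩ := hg
  refine ⟨a * a', b * b', mul_ne_zero hb hb', by simp [div_mul_div_comm], ?_⟩
  rw [poleDegree_mul, poleDegree_mul]
  exact (add_le_add_right h' _).trans_lt
    (WithBot.add_lt_add_right (poleDegree_eq_bot.not.mpr hb') h)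

lemma isBoundedAtInfinity_const (c : K) :
    IsBoundedAtInfinity (algebraMap K W.FunctionField c) := by
  refine ⟨Affine.CoordinateRing.mk W (C (C c)), 1, one_ne_zero, by simp; rfl, ?_⟩
  rw [poleDegree_one]
  rcases eq_or_ne c 0 with rfl | hc
  · simp [poleDegree_eq_bot.mpr]
  · exact (poleDegree_C hc).le

lemma eq_zero_of_isZeroAtInfinity_const {c : K}
    (h : IsZeroAtInfinity (algebraMap K W.FunctionField c)) : c = 0 := by
  obtain ⟨a, b, hb, h, hab⟩ := h
  by_contra hc
  rw [eq_div_iff (by simpa using hb)] at h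
  have : Affine.CoordinateRing.mk W (C (C c)) * b = a := by
    apply IsFractionRing.injective W.CoordinateRing W.FunctionField
    rw [← h, map_mul]
    rfl
  rw [← this, poleDegree_mul, poleDegree_C hc, zero_add] at hab
  exact hab.false

lemma yCoord_ne_zero : Affine.CoordinateRing.mk W Y ≠ 0 := by
  rw [Ne, ← poleDegree_eq_bot, poleDegree_y]
  exact WithBot.coe_ne_bot

lemma yFun_ne_zero : yFun W ≠ 0 := by
  simpa [yFun] using yCoord_ne_zero

lemma xFun_ne_zero : xFun W ≠ 0 := by
  rw [xFun, Ne, map_eq_zero_iff _ (IsFractionRing.injective _ _), ← poleDegree_eq_bot, poleDegree_x]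
  exact WithBot.coe_ne_bot

lemma isZeroAtInfinity_zFun : IsZeroAtInfinity (zFun W) := by
  refine ⟨-Affine.CoordinateRing.mk W (C X), Affine.CoordinateRing.mk W Y, yCoord_ne_zero, ?_, ?_⟩
  · simp [zFun, xFun, yFun, neg_div]
  · rw [← neg_one_mul, poleDegree_mul, poleDegree_x, poleDegree_y]
    have : poleDegree W (-1) = 0 := by simpa using poleDegree_C (W := W) (c := -1) (by simp)
    rw [this]
    decide

lemma isZeroAtInfinity_wFun : IsZeroAtInfinity (wFun W) := by
  refine ⟨-1, Affine.CoordinateRing.mk W Y, yCoord_ne_zero, ?_, ?_⟩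
  · simp [wFun, yFun, neg_div]
  · have : poleDegree W (-1) = 0 := by simpa using poleDegree_C (W := W) (c := -1) (by simp)
    rw [this, poleDegree_y]
    decide

lemma isBoundedAtInfinity_aeval (H : K[X]) : IsBoundedAtInfinity (aeval (zFun W) H) := by
  induction H using Polynomial.induction_on' with
  | add p q hp hq => simpa using hp.add hq
  | monomial n a =>
    rw [aeval_monomial]
    refine (isBoundedAtInfinity_const a).mul ?_
    induction n with
    | zero => simpa using isBoundedAtInfinity_const (W := W) 1
    | succ n ih => rw [pow_succ]; exact ih.mul isZeroAtInfinity_zFun.isBoundedAtInfinity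

lemma isBoundedAtInfinity_aevalAeval (H : K[X][Y]) :
    IsBoundedAtInfinity (aevalAeval (zFun W) (wFun W) H) := by
  induction H using Polynomial.induction_on' with
  | add p q hp hq => simpa using hp.add hq
  | monomial n a =>
    rw [← C_mul_X_pow_eq_monomial, map_mul, aevalAeval_C, map_pow, aevalAeval_Y]
    refine (isBoundedAtInfinity_aeval a).mul ?_
    induction n with
    | zero => simpa using isBoundedAtInfinity_const (W := W) 1
    | succ n ih => rw [pow_succ]; exact ih.mul isZeroAtInfinity_wFun.isBoundedAtInfinity

/-- This makes values in the chart `(z, w)` well defined at `𝓞`. From `H(z, w) = 0` the constant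
term of `H` is a combination of `z` and `w` with bounded coefficients, so it vanishes at infinity; a
constant that does so is `0`. -/
lemma aevalAeval_eq_zero_at_infinity {L : Type*} [Field L] [Algebra K L] (H : K[X][Y])
    (hH : aevalAeval (zFun W) (wFun W) H = 0) : aevalAeval (0 : L) (0 : L) H = 0 := by
  have h₁ : H = Y * H.divX + C (X * (H.coeff 0).divX + C ((H.coeff 0).coeff 0)) := by
    conv_lhs => rw [← X_mul_divX_add H, ← X_mul_divX_add (H.coeff 0)]
  suffices (H.coeff 0).coeff 0 = 0 by rw [h₁, this]; simp
  apply eq_zero_of_isZeroAtInfinity_const (W := W)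
  rw [h₁] at hH
  simp only [map_add, map_mul, aevalAeval_Y, aevalAeval_C, aeval_C, aeval_X] at hH
  rw [show algebraMap K W.FunctionField ((H.coeff 0).coeff 0) =
    (zFun W) * (aeval (zFun W) (-(H.coeff 0).divX)) +
      (wFun W) * (aevalAeval (zFun W) (wFun W) (-H.divX)) by
    simp only [map_neg]; linear_combination hH]
  exact (isZeroAtInfinity_zFun.mul (isBoundedAtInfinity_aeval _)).add
    (isZeroAtInfinity_wFun.mul (isBoundedAtInfinity_aevalAeval _))

end Infinity

section PointRel

variable {K L : Type*} [Field K] [Field L] [Algebra K L] (W : Affine K)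

/-- The evaluation of rational functions at a point of the curve. -/
noncomputable def pointRel : (W.baseChange L).Point → ValueRel K W.FunctionField L
  | .zero => chartRel (zFun W) (wFun W) 0 0 aevalAeval_eq_zero_at_infinity
  | .some x₀ y₀ h => chartRel (xFun W) (yFun W) x₀ y₀ (aevalAeval_eq_zero_of_equation h.1)

lemma pointRel_hasValue (Q : (W.baseChange L).Point) (f : W.FunctionField) (c : L) :
    (pointRel W Q).HasValue f c ↔ HasValueAt W f c Q := by
  cases Q <;> rfl

end PointRel

/-! ### Reduction of points, and addition away from infinity -/

section Reduction

variable {K F L : Type*} [Field K] [Field F] [Field L] [Algebra K F] [Algebra K L]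
  {v : ValueRel K F L} {V : Affine F} {V' : Affine L}

/-- The coefficients of the curve `V` are regular, and their values are those of `V'`. -/
structure CurveReduces (v : ValueRel K F L) (V : Affine F) (V' : Affine L) : Prop where
  a₁ : v.HasValue V.a₁ V'.a₁
  a₂ : v.HasValue V.a₂ V'.a₂
  a₃ : v.HasValue V.a₃ V'.a₃
  a₄ : v.HasValue V.a₄ V'.a₄
  a₆ : v.HasValue V.a₆ V'.a₆

lemma curveReduces_baseChange (v : ValueRel K F L) (W : Affine K) :
    CurveReduces v (W.baseChange F) (W.baseChange L) :=
  ⟨v.const _, v.const _, v.const _, v.const _, v.const _⟩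

/-- The affine point `A` of `V` reduces to the point `A'` of `V'`. -/
def Reduces (v : ValueRel K F L) : V.Point → V'.Point → Prop
  | .some x y _, .some x' y' _ => v.HasValue x x' ∧ v.HasValue y y'
  | .some x y _, .zero => y ≠ 0 ∧ v.HasValue (-(x / y)) 0 ∧ v.HasValue (-(1 / y)) 0
  | .zero, _ => False

/-- By convention `𝓞` reduces to nothing, so proving that a multiple of the generic point reduces
also proves that it is nonzero. -/
lemma Reduces.ne_zero {A : V.Point} {A' : V'.Point} (h : Reduces v A A') : A ≠ 0 := by
  rintro rfl
  exact h

lemma negY_hasValue (hV : CurveReduces v V V') {x y : F} {x' y' : L} (hx : v.HasValue x x')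
    (hy : v.HasValue y y') : v.HasValue (V.negY x y) (V'.negY x' y') :=
  (hy.neg.sub (hV.a₁.mul hx)).sub hV.a₃

section Affine

variable (hV : CurveReduces v V V') {x₁ y₁ x₂ y₂ : F} {x₁' y₁' x₂' y₂' : L}

include hV in
lemma reduces_add_of_slope [DecidableEq F] [DecidableEq L] {h₁ : V.Nonsingular x₁ y₁}
    {h₂ : V.Nonsingular x₂ y₂} {h₁' : V'.Nonsingular x₁' y₁'} {h₂' : V'.Nonsingular x₂' y₂'}
    (hxy : ¬(x₁ = x₂ ∧ y₁ = V.negY x₂ y₂)) (hxy' : ¬(x₁' = x₂' ∧ y₁' = V'.negY x₂' y₂'))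
    (hx₁ : v.HasValue x₁ x₁') (hy₁ : v.HasValue y₁ y₁') (hx₂ : v.HasValue x₂ x₂')
    (hs : v.HasValue (V.slope x₁ x₂ y₁ y₂) (V'.slope x₁' x₂' y₁' y₂')) :
    Reduces v (Affine.Point.some x₁ y₁ h₁ + .some x₂ y₂ h₂)
      (Affine.Point.some x₁' y₁' h₁' + .some x₂' y₂' h₂') := by
  rw [Affine.Point.add_some hxy, Affine.Point.add_some hxy']
  have hX : v.HasValue (V.addX x₁ x₂ (V.slope x₁ x₂ y₁ y₂))
      (V'.addX x₁' x₂' (V'.slope x₁' x₂' y₁' y₂')) :=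
    ((((hs.pow 2).add (hV.a₁.mul hs)).sub hV.a₂).sub hx₁).sub hx₂
  exact ⟨hX, negY_hasValue hV hX ((hs.mul (hX.sub hx₁)).add hy₁)⟩

include hV in
-- If the slope `ℓ` has a pole, the sum has `x ~ ℓ²` and `y ~ -ℓ³`. So it tends to `𝓞`, and its
-- `z`-coordinate is asymptotic to `1/ℓ`.
lemma reduces_add_of_inv_slope [DecidableEq F] {h₁ : V.Nonsingular x₁ y₁}
    {h₂ : V.Nonsingular x₂ y₂} (hxy : ¬(x₁ = x₂ ∧ y₁ = V.negY x₂ y₂))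
    (hx₁ : v.HasValue x₁ x₁') (hy₁ : v.HasValue y₁ y₁') (hx₂ : v.HasValue x₂ x₂')
    (h₀ : V.slope x₁ x₂ y₁ y₂ ≠ 0) (hs : v.HasValue (V.slope x₁ x₂ y₁ y₂)⁻¹ 0) :
    Reduces v (Affine.Point.some x₁ y₁ h₁ + .some x₂ y₂ h₂) (0 : V'.Point) ∧
      v.HasValue (V.slope x₁ x₂ y₁ y₂ *
        zCoord (Affine.Point.some x₁ y₁ h₁ + .some x₂ y₂ h₂)) 1 := by
  rw [Affine.Point.add_some hxy]
  set ℓ := V.slope x₁ x₂ y₁ y₂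
  obtain ⟨a₁, a₂, a₃, a₄, a₆⟩ := hV
  have hX : v.HasValue (ℓ⁻¹ ^ 2 * V.addX x₁ x₂ ℓ) 1 := by
    refine (v.one.add ((a₁.mul hs).sub ((hs.pow 2).mul ((a₂.add hx₁).add hx₂)))).congr ?_ (by simp)
    rw [Affine.addX]
    field_simp
    ring
  have hY : v.HasValue (ℓ⁻¹ ^ 3 * V.addY x₁ x₂ y₁ ℓ) (-1) := by
    refine (hX.neg.add (((hs.pow 2).mul hx₁).sub ((hs.mul (a₁.mul hX)).add
      ((hs.pow 3).mul (hy₁.add a₃))))).congr ?_ (by simp)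
    rw [Affine.addY, Affine.negY, Affine.negAddY]
    field_simp
    ring
  have hY₀ : V.addY x₁ x₂ y₁ ℓ ≠ 0 := right_ne_zero_of_mul (hY.ne_zero (by simp))
  have hz : v.HasValue (ℓ * -(V.addX x₁ x₂ ℓ / V.addY x₁ x₂ y₁ ℓ)) 1 := by
    refine (hX.div hY.neg (by simp)).congr ?_ (by simp)
    field_simp
  have hz' : v.HasValue (-(V.addX x₁ x₂ ℓ / V.addY x₁ x₂ y₁ ℓ)) 0 :=
    (hs.mul hz).congr (by field_simp) (by simp)
  have hw : v.HasValue (-(1 / V.addY x₁ x₂ y₁ ℓ)) 0 :=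
    ((hs.pow 3).div hY.neg (by simp)).congr (by field_simp) (by simp)
  exact ⟨⟨hY₀, hz', hw⟩, hz⟩

/-- The difference of the two curve equations, factored. It resolves the slope of a chord when its
numerator and denominator both reduce to `0`. -/
lemma chord_mul_eq (h₁ : V.Equation x₁ y₁) (h₂ : V.Equation x₂ y₂) :
    (y₁ - y₂) * (y₁ - V.negY x₂ y₂) =
      (x₁ - x₂) * (x₁ ^ 2 + x₁ * x₂ + x₂ ^ 2 + V.a₂ * (x₁ + x₂) + V.a₄ - V.a₁ * y₁) := by
  rw [Affine.equation_iff] at h₁ h₂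
  rw [Affine.negY]
  linear_combination h₁ - h₂

/-- At a point of order two the `y`-derivative of the equation vanishes, so nonsingularity forces
the `x`-derivative not to. -/
lemma tangent_ne_zero (h : V.Nonsingular x₁ y₁) (hy : y₁ = V.negY x₁ y₁) :
    3 * x₁ ^ 2 + 2 * V.a₂ * x₁ + V.a₄ - V.a₁ * y₁ ≠ 0 := by
  rw [Affine.nonsingular_iff] at h
  rcases h.2 with h | h
  · exact fun h' => h (by linear_combination -h')
  · exact absurd hy h

include hV in
lemma chord_numerator_hasValue (hx₁ : v.HasValue x₁ x₁') (hy₁ : v.HasValue y₁ y₁')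
    (hx₂ : v.HasValue x₂ x₁') :
    v.HasValue (x₁ ^ 2 + x₁ * x₂ + x₂ ^ 2 + V.a₂ * (x₁ + x₂) + V.a₄ - V.a₁ * y₁)
      (3 * x₁' ^ 2 + 2 * V'.a₂ * x₁' + V'.a₄ - V'.a₁ * y₁') := by
  obtain ⟨a₁, a₂, a₃, a₄, a₆⟩ := hV
  exact (((((((hx₁.pow 2).add (hx₁.mul hx₂)).add (hx₂.pow 2)).add (a₂.mul (hx₁.add hx₂))).add
    a₄).sub (a₁.mul hy₁))).congr rfl (by ring)

include hV in
-- Where `x₁' = x₂'`, `chord_mul_eq` lets the slope be rewritten as `N / (y₁ - negY x₂ y₂)`, with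
-- `N` tending to the tangent numerator. If the reduced points are opposite, the slope has a pole:
-- either `y₁' ≠ y₂'`, or the common point is 2-torsion and `N` is a unit by `tangent_ne_zero`.
lemma reduces_add_of_affine [DecidableEq F] [DecidableEq L] {h₁ : V.Nonsingular x₁ y₁}
    {h₂ : V.Nonsingular x₂ y₂} {h₁' : V'.Nonsingular x₁' y₁'} {h₂' : V'.Nonsingular x₂' y₂'}
    (hx : x₁ ≠ x₂) (hx₁ : v.HasValue x₁ x₁') (hy₁ : v.HasValue y₁ y₁') (hx₂ : v.HasValue x₂ x₂')
    (hy₂ : v.HasValue y₂ y₂') :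
    Reduces v (Affine.Point.some x₁ y₁ h₁ + .some x₂ y₂ h₂)
      (Affine.Point.some x₁' y₁' h₁' + .some x₂' y₂' h₂') ∧
    (x₁' = x₂' ∧ y₁' = V'.negY x₂' y₂' → (y₁ - y₂) / (x₁ - x₂) ≠ 0 ∧
      v.HasValue ((y₁ - y₂) / (x₁ - x₂) *
        zCoord (Affine.Point.some x₁ y₁ h₁ + .some x₂ y₂ h₂)) 1) := by
  have hxy : ¬(x₁ = x₂ ∧ y₁ = V.negY x₂ y₂) := fun h => hx h.1
  have hs := V.slope_of_X_ne hx (y₁ := y₁) (y₂ := y₂)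
  have hN := chord_mul_eq h₁.1 h₂.1
  have hx' := sub_ne_zero.mpr hx
  have hn := negY_hasValue hV hx₂ hy₂
  by_cases hxy' : x₁' = x₂' ∧ y₁' = V'.negY x₂' y₂'
  · suffices (y₁ - y₂) / (x₁ - x₂) ≠ 0 ∧ v.HasValue ((y₁ - y₂) / (x₁ - x₂))⁻¹ 0 by
      rw [← hs] at this ⊢
      have := reduces_add_of_inv_slope hV (h₁ := h₁) (h₂ := h₂) hxy hx₁ hy₁ hx₂ this.1 this.2
      rw [Affine.Point.add_of_Y_eq hxy'.1 hxy'.2]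
      tauto
    by_cases hy : y₁' = y₂'
    · obtain rfl : x₁' = x₂' := hxy'.1
      subst hy
      have hN' := chord_numerator_hasValue hV hx₁ hy₁ hx₂
      have hN₀ := tangent_ne_zero h₁' hxy'.2
      have hi := (((hy₁.sub hn).div hN' hN₀).congr rfl (by rw [← hxy'.2, sub_self, zero_div]) :
        v.HasValue _ 0)
      have h₃ := hN'.ne_zero hN₀
      have h₄ : (y₁ - y₂) * (y₁ - V.negY x₂ y₂) ≠ 0 := by
        rw [hN]; exact mul_ne_zero hx' h₃
      refine ⟨div_ne_zero (left_ne_zero_of_mul h₄) hx', hi.congr ?_ rfl⟩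
      have := left_ne_zero_of_mul h₄
      rw [inv_div, div_eq_div_iff h₃ this]
      linear_combination hN
    · have hy' := sub_ne_zero.mpr hy
      refine ⟨div_ne_zero ((hy₁.sub hy₂).ne_zero hy') hx', ?_⟩
      exact ((hx₁.sub hx₂).div (hy₁.sub hy₂) hy').congr (by simp) (by simp [hxy'.1])
  · refine ⟨?_, fun h => (hxy' h).elim⟩
    apply reduces_add_of_slope hV hxy hxy' hx₁ hy₁ hx₂
    rw [hs]
    by_cases h : x₁' = x₂'
    · have hy : y₁' ≠ V'.negY x₂' y₂' := fun hy => hxy' ⟨h, hy⟩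
      rw [V'.slope_of_Y_ne h hy]
      have hyy := Affine.Y_eq_of_Y_ne h₁'.1 h₂'.1 h hy
      subst h hyy
      have hd := sub_ne_zero.mpr hy
      refine ((chord_numerator_hasValue hV hx₁ hy₁ hx₂).div (hy₁.sub hn) hd).congr ?_ rfl
      have := (hy₁.sub hn).ne_zero hd
      field_simp
      linear_combination -hN
    · rw [V'.slope_of_X_ne h]
      exact (hy₁.sub hy₂).div (hx₁.sub hx₂) (sub_ne_zero.mpr h)

end Affine

end Reduction

/-! ### The coordinates `(z, w)` near infinity and lines in them -/

section Formal

variable {K F L : Type*} [Field K] [Field F] [Field L] [Algebra K F] [Algebra K L]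

/-- The point with coordinates `z = -x/y` and `w = -1/y` is an affine point of `V`, and it reduces
to the point at infinity. -/
structure IsNearInfinity (v : ValueRel K F L) (V : Affine F) (z w : F) : Prop where
  w_ne_zero : w ≠ 0
  z_hasValue : v.HasValue z 0
  w_hasValue : v.HasValue w 0
  eqn : w = z ^ 3 + V.a₁ * z * w + V.a₂ * z ^ 2 * w + V.a₃ * w ^ 2 + V.a₄ * z * w ^ 2 +
    V.a₆ * w ^ 3

variable {v : ValueRel K F L} {V : Affine F} {V' : Affine L}

lemma isNearInfinity_of_reduces {x y : F} {h : V.Nonsingular x y}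
    (hA : Reduces v (Affine.Point.some x y h) (0 : V'.Point)) :
    IsNearInfinity v V (-(x / y)) (-(1 / y)) := by
  obtain ⟨hy, hz, hw⟩ := hA
  refine ⟨by simpa using hy, hz, hw, ?_⟩
  have := (Affine.equation_iff ..).mp h.1
  field_simp
  linear_combination -this

lemma exists_isNearInfinity {x y : F} {h : V.Nonsingular x y}
    (hA : Reduces v (Affine.Point.some x y h) (0 : V'.Point)) :
    ∃ z w, IsNearInfinity v V z w ∧ x = z / w ∧ y = -(1 / w) ∧
      zCoord (Affine.Point.some x y h) = z := by
  have hy : y ≠ 0 := hA.1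
  exact ⟨_, _, isNearInfinity_of_reduces hA, by field_simp, by field_simp, rfl⟩

lemma reduces_of_isNearInfinity {z w x y : F} (hzw : IsNearInfinity v V z w)
    {h : V.Nonsingular x y} (hx : x = z / w) (hy : y = -(1 / w)) :
    Reduces v (Affine.Point.some x y h) (0 : V'.Point) ∧
      zCoord (Affine.Point.some x y h) = z := by
  have hw := hzw.w_ne_zero
  have hz : -(x / y) = z := by rw [hx, hy]; field_simp
  refine ⟨⟨by rw [hy]; simpa using hw, hzw.z_hasValue.congr hz.symm rfl,
    hzw.w_hasValue.congr (by rw [hy]; field_simp) rfl⟩, hz⟩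

namespace IsNearInfinity

variable {z w : F} (hzw : IsNearInfinity v V z w)

include hzw

/-- The curve equation solved for `w` up to a unit: `w ~ z³`. The remainder `E` makes the expansion
of `D` explicit to third order, the precision needed in `reduces_add_near_infinity`. -/
lemma exists_mul_eq (hV : CurveReduces v V V') :
    ∃ D E, v.HasValue D 1 ∧ w * D = z ^ 3 ∧ v.HasValue E V'.a₃ ∧
      D = 1 - V.a₁ * z - V.a₂ * z ^ 2 - z ^ 3 * E := by
  obtain ⟨a₁, a₂, a₃, a₄, a₆⟩ := hV
  obtain ⟨hw₀, hz, hw, h⟩ := hzw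
  set D := 1 - V.a₁ * z - V.a₂ * z ^ 2 - V.a₃ * w - V.a₄ * z * w - V.a₆ * w ^ 2 with hD
  have hD₁ : v.HasValue D 1 :=
    ((((((v.one.sub (a₁.mul hz)).sub (a₂.mul (hz.pow 2))).sub (a₃.mul hw)).sub
      ((a₄.mul hz).mul hw)).sub (a₆.mul (hw.pow 2)))).congr rfl (by simp)
  have hD₀ := hD₁.ne_zero one_ne_zero
  have hwD : w * D = z ^ 3 := by
    rw [hD]
    linear_combination h
  refine ⟨D, (V.a₃ + V.a₄ * z + V.a₆ * w) / D, hD₁, hwD,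
    (((a₃.add (a₄.mul hz)).add (a₆.mul hw)).div hD₁ one_ne_zero).congr rfl (by simp), ?_⟩
  rw [← hwD, mul_div_assoc', mul_comm w, mul_assoc, mul_div_cancel_left₀ _ hD₀, hD]
  ring

lemma z_ne_zero (hV : CurveReduces v V V') : z ≠ 0 := by
  rintro rfl
  obtain ⟨D, E, hD, h, -⟩ := hzw.exists_mul_eq hV
  exact mul_ne_zero hzw.w_ne_zero (hD.ne_zero one_ne_zero) (by rw [h]; ring)

lemma cube_div_hasValue (hV : CurveReduces v V V') : v.HasValue (z ^ 3 / w) 1 := by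
  obtain ⟨D, E, hD, h, -⟩ := hzw.exists_mul_eq hV
  have hw := hzw.w_ne_zero
  exact hD.congr (by rw [← h]; field_simp) rfl

lemma slope_hasValue (hV : CurveReduces v V V') : v.HasValue (w / z) 0 := by
  refine ((hzw.z_hasValue.pow 2).div (hzw.cube_div_hasValue hV) one_ne_zero).congr ?_ (by simp)
  field_simp

lemma neg_denom_hasValue (hV : CurveReduces v V V') :
    v.HasValue (1 - V.a₁ * z - V.a₃ * w) 1 :=
  ((v.one.sub (hV.a₁.mul hzw.z_hasValue)).sub (hV.a₃.mul hzw.w_hasValue)).congr rfl (by simp)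

lemma negY_eq : V.negY (z / w) (-(1 / w)) = (1 - V.a₁ * z - V.a₃ * w) / w := by
  have hw := hzw.w_ne_zero
  rw [Affine.negY]
  field_simp

lemma neg (hV : CurveReduces v V V') : IsNearInfinity v V (-(z / (1 - V.a₁ * z - V.a₃ * w)))
    (-(w / (1 - V.a₁ * z - V.a₃ * w))) := by
  have hδ := hzw.neg_denom_hasValue hV
  have hδ₀ := hδ.ne_zero one_ne_zero
  have h := hzw.eqn
  have hw₀ := hzw.w_ne_zero
  obtain ⟨δ, hδ'⟩ : ∃ δ, δ = 1 - V.a₁ * z - V.a₃ * w := ⟨_, rfl⟩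
  rw [← hδ'] at hδ hδ₀ ⊢
  refine ⟨by simp [hw₀, hδ₀], (hzw.z_hasValue.div hδ one_ne_zero).neg.congr rfl (by simp),
    (hzw.w_hasValue.div hδ one_ne_zero).neg.congr rfl (by simp), ?_⟩
  suffices w * δ ^ 2 = z ^ 3 - V.a₁ * z * w * δ + V.a₂ * z ^ 2 * w - V.a₃ * w ^ 2 * δ +
      V.a₄ * z * w ^ 2 + V.a₆ * w ^ 3 by
    field_simp
    linear_combination -this
  linear_combination h + (w * δ + w) * hδ'

end IsNearInfinity

/-- The three points with coordinates `(zᵢ, wᵢ)` are the intersection points, near infinity, of the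
curve with the line `w = ℓ z + ν`; the last three fields are Vieta's formulas. -/
structure CollinearNearInfinity (v : ValueRel K F L) (V : Affine F) (ℓ ν z₁ w₁ z₂ w₂ z₃ w₃ : F) :
    Prop where
  near₁ : IsNearInfinity v V z₁ w₁
  near₂ : IsNearInfinity v V z₂ w₂
  near₃ : IsNearInfinity v V z₃ w₃
  ℓ_hasValue : v.HasValue ℓ 0
  ν_ne_zero : ν ≠ 0
  line₁ : w₁ = ℓ * z₁ + ν
  line₂ : w₂ = ℓ * z₂ + ν
  line₃ : w₃ = ℓ * z₃ + ν
  sum_one : (1 + V.a₂ * ℓ + V.a₄ * ℓ ^ 2 + V.a₆ * ℓ ^ 3) * (z₁ + z₂ + z₃) =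
    -(V.a₁ * ℓ + V.a₃ * ℓ ^ 2 + V.a₂ * ν + 2 * V.a₄ * ℓ * ν + 3 * V.a₆ * ℓ ^ 2 * ν)
  sum_two : (1 + V.a₂ * ℓ + V.a₄ * ℓ ^ 2 + V.a₆ * ℓ ^ 3) * (z₁ * z₂ + z₁ * z₃ + z₂ * z₃) =
    V.a₁ * ν + 2 * V.a₃ * ℓ * ν + V.a₄ * ν ^ 2 + 3 * V.a₆ * ℓ * ν ^ 2 - ℓ
  prod : (1 + V.a₂ * ℓ + V.a₄ * ℓ ^ 2 + V.a₆ * ℓ ^ 3) * (z₁ * z₂ * z₃) =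
    ν - V.a₃ * ν ^ 2 - V.a₆ * ν ^ 3

lemma leadingCoeff_hasValue (hV : CurveReduces v V V') {ℓ : F} (hℓ : v.HasValue ℓ 0) :
    v.HasValue (1 + V.a₂ * ℓ + V.a₄ * ℓ ^ 2 + V.a₆ * ℓ ^ 3) 1 :=
  (((v.one.add (hV.a₂.mul hℓ)).add (hV.a₄.mul (hℓ.pow 2))).add (hV.a₆.mul (hℓ.pow 3))).congr rfl
    (by simp)

/-- Substituting `w = ℓz + ν` in the curve gives a cubic in `z`, and `z₃` is its third root. The
hypothesis `hq` is the vanishing of the divided difference of the cubic at `z₁, z₂`, which becomes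
its derivative when `z₁ = z₂`; so chords and tangents are treated together. -/
lemma exists_collinearNearInfinity (hV : CurveReduces v V V') {ℓ ν z₁ w₁ z₂ w₂ : F}
    (h₁ : IsNearInfinity v V z₁ w₁) (h₂ : IsNearInfinity v V z₂ w₂) (hℓ : v.HasValue ℓ 0)
    (hν₀ : ν ≠ 0) (hl₁ : w₁ = ℓ * z₁ + ν) (hl₂ : w₂ = ℓ * z₂ + ν)
    (hq : (1 + V.a₂ * ℓ + V.a₄ * ℓ ^ 2 + V.a₆ * ℓ ^ 3) * (z₁ ^ 2 + z₁ * z₂ + z₂ ^ 2) +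
      (V.a₁ * ℓ + V.a₃ * ℓ ^ 2 + V.a₂ * ν + 2 * V.a₄ * ℓ * ν + 3 * V.a₆ * ℓ ^ 2 * ν) * (z₁ + z₂) +
      (V.a₁ * ν + 2 * V.a₃ * ℓ * ν + V.a₄ * ν ^ 2 + 3 * V.a₆ * ℓ * ν ^ 2 - ℓ) = 0) :
    ∃ z₃ w₃, CollinearNearInfinity v V ℓ ν z₁ w₁ z₂ w₂ z₃ w₃ := by
  have hν : v.HasValue ν 0 := (h₁.w_hasValue.sub (hℓ.mul h₁.z_hasValue)).congr
    (by rw [hl₁]; ring) (by simp)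
  have hc := leadingCoeff_hasValue hV hℓ
  have hc₀ := hc.ne_zero one_ne_zero
  have hp : v.HasValue (V.a₁ * ℓ + V.a₃ * ℓ ^ 2 + V.a₂ * ν + 2 * V.a₄ * ℓ * ν +
      3 * V.a₆ * ℓ ^ 2 * ν) 0 :=
    (((((hV.a₁.mul hℓ).add (hV.a₃.mul (hℓ.pow 2))).add (hV.a₂.mul hν)).add
      ((((v.ofNat 2).mul hV.a₄).mul hℓ).mul hν)).add
      ((((v.ofNat 3).mul hV.a₆).mul (hℓ.pow 2)).mul hν)).congr rfl (by simp)
  have hz₃ := (((hp.div hc one_ne_zero).neg.sub h₁.z_hasValue).sub h₂.z_hasValue)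
  have hr : v.HasValue (1 - V.a₃ * ν - V.a₆ * ν ^ 2) 1 :=
    ((v.one.sub (hV.a₃.mul hν)).sub (hV.a₆.mul (hν.pow 2))).congr rfl (by simp)
  set c := 1 + V.a₂ * ℓ + V.a₄ * ℓ ^ 2 + V.a₆ * ℓ ^ 3 with hcdef
  set p := V.a₁ * ℓ + V.a₃ * ℓ ^ 2 + V.a₂ * ν + 2 * V.a₄ * ℓ * ν + 3 * V.a₆ * ℓ ^ 2 * ν with hpdef
  set q := V.a₁ * ν + 2 * V.a₃ * ℓ * ν + V.a₄ * ν ^ 2 + 3 * V.a₆ * ℓ * ν ^ 2 - ℓ with hqdef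
  set z₃ := -(p / c) - z₁ - z₂ with hz₃def
  have e₁ : c * (z₁ + z₂ + z₃) = -p := by
    rw [hz₃def]; field_simp; ring
  have e₂ : c * (z₁ * z₂ + z₁ * z₃ + z₂ * z₃) = q := by
    linear_combination (z₁ + z₂) * e₁ - hq
  have hP : c * z₁ ^ 3 + p * z₁ ^ 2 + q * z₁ + (V.a₃ * ν ^ 2 + V.a₆ * ν ^ 3 - ν) = 0 := by
    have := h₁.eqn
    rw [hl₁] at this
    rw [hcdef, hpdef, hqdef]
    linear_combination -this
  have e₃ : c * (z₁ * z₂ * z₃) = ν - V.a₃ * ν ^ 2 - V.a₆ * ν ^ 3 := by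
    linear_combination hP - z₁ ^ 2 * e₁ + z₁ * e₂
  have hz₃₀ : z₃ ≠ 0 := by
    intro h
    rw [h] at e₃
    exact mul_ne_zero hν₀ (hr.ne_zero one_ne_zero) (by linear_combination -e₃)
  have hP₃ : c * z₃ ^ 3 + p * z₃ ^ 2 + q * z₃ + (V.a₃ * ν ^ 2 + V.a₆ * ν ^ 3 - ν) = 0 := by
    linear_combination z₃ ^ 2 * e₁ - z₃ * e₂ + e₃
  have heqn : ℓ * z₃ + ν = z₃ ^ 3 + V.a₁ * z₃ * (ℓ * z₃ + ν) + V.a₂ * z₃ ^ 2 * (ℓ * z₃ + ν) +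
      V.a₃ * (ℓ * z₃ + ν) ^ 2 + V.a₄ * z₃ * (ℓ * z₃ + ν) ^ 2 + V.a₆ * (ℓ * z₃ + ν) ^ 3 := by
    rw [hcdef, hpdef, hqdef] at hP₃
    linear_combination -hP₃
  refine ⟨z₃, ℓ * z₃ + ν, h₁, h₂, ⟨?_, hz₃.congr rfl (by simp),
    ((hℓ.mul hz₃).add hν).congr rfl (by simp), heqn⟩, hℓ, hν₀, hl₁, hl₂, rfl, e₁, e₂, e₃⟩
  intro h
  rw [h] at heqn
  exact pow_ne_zero 3 hz₃₀ (by linear_combination -heqn)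

namespace CollinearNearInfinity

variable {ℓ ν z₁ w₁ z₂ w₂ z₃ w₃ : F} (h : CollinearNearInfinity v V ℓ ν z₁ w₁ z₂ w₂ z₃ w₃)

include h

lemma rotate : CollinearNearInfinity v V ℓ ν z₃ w₃ z₁ w₁ z₂ w₂ where
  near₁ := h.near₃
  near₂ := h.near₁
  near₃ := h.near₂
  ℓ_hasValue := h.ℓ_hasValue
  ν_ne_zero := h.ν_ne_zero
  line₁ := h.line₃
  line₂ := h.line₁
  line₃ := h.line₂
  sum_one := by linear_combination h.sum_one
  sum_two := by linear_combination h.sum_two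
  prod := by linear_combination h.prod

lemma ν_hasValue : v.HasValue ν 0 :=
  (h.near₁.w_hasValue.sub (h.ℓ_hasValue.mul h.near₁.z_hasValue)).congr
    (by rw [h.line₁]; ring) (by simp)

lemma prod_hasValue (hV : CurveReduces v V V') : v.HasValue (z₁ * z₂ * z₃ / ν) 1 := by
  have hν := h.ν_hasValue
  have hν₀ := h.ν_ne_zero
  have hc := leadingCoeff_hasValue hV h.ℓ_hasValue
  have hc₀ := hc.ne_zero one_ne_zero
  have hr : v.HasValue (1 - V.a₃ * ν - V.a₆ * ν ^ 2) 1 :=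
    ((v.one.sub (hV.a₃.mul hν)).sub (hV.a₆.mul (hν.pow 2))).congr rfl (by simp)
  refine (hr.div hc one_ne_zero).congr ?_ (by simp)
  rw [div_eq_div_iff hc₀ hν₀]
  linear_combination -h.prod

/-- With `wᵢ = ℓzᵢ + ν` and denominators cleared, the claim is symmetric in the three points and
follows from Vieta's formulas. -/
lemma addX_eq (hV : CurveReduces v V V') : V.addX (z₁ / w₁) (z₂ / w₂) (ℓ / ν) = z₃ / w₃ := by
  have hν := h.ν_ne_zero
  have hw₁ := h.near₁.w_ne_zero
  have hw₂ := h.near₂.w_ne_zero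
  have hw₃ := h.near₃.w_ne_zero
  have hc₀ := (leadingCoeff_hasValue hV h.ℓ_hasValue).ne_zero one_ne_zero
  obtain ⟨-, -, -, -, -, h₁, h₂, h₃, e₁, e₂, e₃⟩ := h
  rw [Affine.addX]
  suffices (ℓ ^ 2 + V.a₁ * ℓ * ν - V.a₂ * ν ^ 2) * (w₁ * w₂ * w₃) =
      ν ^ 2 * (z₁ * w₂ * w₃ + z₂ * w₁ * w₃ + z₃ * w₁ * w₂) by
    field_simp
    linear_combination this
  apply mul_left_cancel₀ hc₀
  rw [h₁, h₂, h₃]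
  linear_combination (ℓ ^ 2 + V.a₁ * ℓ * ν - V.a₂ * ν ^ 2) *
    (ℓ ^ 3 * e₃ + ℓ ^ 2 * ν * e₂ + ℓ * ν ^ 2 * e₁) -
    ν ^ 2 * (3 * ℓ ^ 2 * e₃ + 2 * ℓ * ν * e₂ + ν ^ 2 * e₁)

lemma addY_eq : ℓ / ν * (z₃ / w₃ - z₁ / w₁) + -(1 / w₁) = -(1 / w₃) := by
  have hν := h.ν_ne_zero
  have hw₁ := h.near₁.w_ne_zero
  have hw₃ := h.near₃.w_ne_zero
  field_simp
  linear_combination w₃ * h.line₁ - w₁ * h.line₃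

/-- The first-order formal group law: as `P₁ = -P₃ - P₂`, `z₁` is asymptotic to `z(-P₃) - z₂`,
cleared here of the denominator `1 - a₁z₃ - a₃w₃`. The error in Vieta's formulas is a multiple of
`z₁` because `ν = (w₁/z₁ - ℓ) z₁`. -/
lemma sum_hasValue (hV : CurveReduces v V V') :
    v.HasValue ((-z₃ - z₂ + V.a₁ * z₂ * z₃ + V.a₃ * z₂ * w₃) / z₁) 1 := by
  have hz₁ := h.near₁.z_ne_zero hV
  have hω := h.near₁.slope_hasValue hV
  have hν := h.ν_hasValue
  have hℓ := h.ℓ_hasValue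
  have hc := leadingCoeff_hasValue hV hℓ
  have hc₀ := hc.ne_zero one_ne_zero
  have hz₂ := h.near₂.z_hasValue
  have hz₃ := h.near₃.z_hasValue
  obtain ⟨-, -, -, -, -, h₁, h₂, h₃, e₁, e₂, e₃⟩ := h
  set ω := w₁ / z₁ with hωdef
  have hw₁ : w₁ = ω * z₁ := by rw [hωdef]; field_simp
  have hS : v.HasValue ((ω - ℓ) * (V.a₁ + 2 * V.a₃ * ℓ + V.a₄ * ν + 3 * V.a₆ * ℓ * ν) -
      (1 + V.a₂ * ℓ + V.a₄ * ℓ ^ 2 + V.a₆ * ℓ ^ 3) * (z₂ + z₃)) 0 :=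
    (((hω.sub hℓ).mul (((hV.a₁.add (((v.ofNat 2).mul hV.a₃).mul hℓ)).add (hV.a₄.mul hν)).add
      ((((v.ofNat 3).mul hV.a₆).mul hℓ).mul hν))).sub (hc.mul (hz₂.add hz₃))).congr rfl (by simp)
  have hT := v.one.add ((((hV.a₁.mul hS).add (hV.a₃.mul ((hℓ.mul hS).add
    ((hc.mul hz₂).mul (hω.sub hℓ))))).add ((hω.sub hℓ).mul ((hV.a₂.add
      (((v.ofNat 2).mul hV.a₄).mul hℓ)).add (((v.ofNat 3).mul hV.a₆).mul (hℓ.pow 2))))).div hc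
      one_ne_zero)
  refine hT.congr ?_ (by simp)
  have hν' : ν = (ω - ℓ) * z₁ := by linear_combination hw₁ - h₁
  rw [eq_div_iff hz₁, h₃]
  apply mul_left_cancel₀ hc₀
  rw [← mul_assoc, mul_add, mul_div_cancel₀ _ hc₀]
  linear_combination e₁ - (V.a₁ + V.a₃ * ℓ) * e₂ - ((V.a₁ + V.a₃ * ℓ) *
    (V.a₁ + 2 * V.a₃ * ℓ + V.a₄ * ν + 3 * V.a₆ * ℓ * ν) +
    V.a₃ * (1 + V.a₂ * ℓ + V.a₄ * ℓ ^ 2 + V.a₆ * ℓ ^ 3) * z₂ +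
    V.a₂ + 2 * V.a₄ * ℓ + 3 * V.a₆ * ℓ ^ 2) * hν'

end CollinearNearInfinity

end Formal

/-! ### Addition of points near infinity -/

section FormalAdd

variable {K F L : Type*} [Field K] [Field F] [Field L] [Algebra K F] [Algebra K L]
  {v : ValueRel K F L} {V : Affine F} {V' : Affine L} (hV : CurveReduces v V V')
  {x₁ y₁ x₂ y₂ : F}

include hV

lemma reduces_neg {A : V.Point} {A' : V'.Point} (hA : Reduces v A A') : Reduces v (-A) (-A') := by
  rcases A with _ | ⟨x, y, h⟩
  · exact hA.elim
  rcases A' with _ | ⟨x', y', h'⟩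
  · obtain ⟨z, w, hzw, rfl, rfl, -⟩ := exists_isNearInfinity hA
    have hδ := (hzw.neg_denom_hasValue hV).ne_zero one_ne_zero
    refine (reduces_of_isNearInfinity (hzw.neg hV) ?_ ?_).1
    · rw [neg_div_neg_eq, div_div_div_cancel_right₀ hδ]
    · rw [hzw.negY_eq]
      field_simp
  · exact ⟨hA.1, negY_hasValue hV hA.1 hA.2⟩

lemma reduces_add_of_collinear [DecidableEq F] {h₁ : V.Nonsingular x₁ y₁}
    {h₂ : V.Nonsingular x₂ y₂} (hxy : ¬(x₁ = x₂ ∧ y₁ = V.negY x₂ y₂))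
    {ℓ ν z₁ w₁ z₂ w₂ z₃ w₃ : F} (h : CollinearNearInfinity v V ℓ ν z₁ w₁ z₂ w₂ z₃ w₃)
    (hx₁ : x₁ = z₁ / w₁) (hy₁ : y₁ = -(1 / w₁)) (hx₂ : x₂ = z₂ / w₂)
    (hs : V.slope x₁ x₂ y₁ y₂ = ℓ / ν) :
    Reduces v (Affine.Point.some x₁ y₁ h₁ + .some x₂ y₂ h₂) (0 : V'.Point) ∧
      zCoord (Affine.Point.some x₁ y₁ h₁ + .some x₂ y₂ h₂) =
        -(z₃ / (1 - V.a₁ * z₃ - V.a₃ * w₃)) ∧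
      zCoord (-(Affine.Point.some x₁ y₁ h₁ + .some x₂ y₂ h₂)) = z₃ := by
  rw [Affine.Point.add_some hxy]
  have hw := h.near₃.w_ne_zero
  have hδ := (h.near₃.neg_denom_hasValue hV).ne_zero one_ne_zero
  have hX : V.addX x₁ x₂ (V.slope x₁ x₂ y₁ y₂) = z₃ / w₃ := by
    rw [hs, hx₁, hx₂, h.addX_eq hV]
  have hY' : V.negAddY x₁ x₂ y₁ (V.slope x₁ x₂ y₁ y₂) = -(1 / w₃) := by
    rw [Affine.negAddY, hX, hs, hx₁, hy₁, h.addY_eq]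
  have hY : V.addY x₁ x₂ y₁ (V.slope x₁ x₂ y₁ y₂) = (1 - V.a₁ * z₃ - V.a₃ * w₃) / w₃ := by
    rw [Affine.addY, hX, hY', h.near₃.negY_eq]
  have := reduces_of_isNearInfinity (V' := V') (h.near₃.neg hV)
    (h := V.nonsingular_add h₁ h₂ hxy) 
    (by rw [hX, neg_div_neg_eq, div_div_div_cancel_right₀ hδ]) (by rw [hY]; field_simp)
  refine ⟨this.1, this.2, ?_⟩
  rw [Affine.Point.neg_some]
  simp only [zCoord]
  rw [hY, hX, ← h.near₃.negY_eq, Affine.negY_negY]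
  field_simp

/-- Subtracting the two curve equations gives `(w₁ - w₂) M = (z₁ - z₂) N` with `M` of value `1` and
`N` of value `0`; so the slope `N / M` is regular and vanishes at `𝓞`. -/
lemma exists_collinear_chord [DecidableEq F] {z₁ w₁ z₂ w₂ : F} (h₁ : IsNearInfinity v V z₁ w₁)
    (h₂ : IsNearInfinity v V z₂ w₂) (hx : z₁ / w₁ ≠ z₂ / w₂) :
    ∃ ℓ ν z₃ w₃, CollinearNearInfinity v V ℓ ν z₁ w₁ z₂ w₂ z₃ w₃ ∧
      V.slope (z₁ / w₁) (z₂ / w₂) (-(1 / w₁)) (-(1 / w₂)) = ℓ / ν ∧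
      ν * (z₁ - z₂) = w₁ * w₂ * (z₁ / w₁ - z₂ / w₂) := by
  rw [V.slope_of_X_ne hx]
  have hw₁ := h₁.w_ne_zero
  have hw₂ := h₂.w_ne_zero
  obtain ⟨M, hM⟩ : ∃ M, M = 1 - V.a₁ * z₂ - V.a₂ * z₂ ^ 2 - V.a₃ * (w₁ + w₂) -
    V.a₄ * z₂ * (w₁ + w₂) - V.a₆ * (w₁ ^ 2 + w₁ * w₂ + w₂ ^ 2) := ⟨_, rfl⟩
  obtain ⟨N, hN⟩ : ∃ N, N = z₁ ^ 2 + z₁ * z₂ + z₂ ^ 2 + V.a₁ * w₁ + V.a₂ * (z₁ + z₂) * w₁ +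
    V.a₄ * w₁ ^ 2 := ⟨_, rfl⟩
  have e₁ := h₁.eqn
  have e₂ := h₂.eqn
  have z₁v := h₁.z_hasValue
  have z₂v := h₂.z_hasValue
  have w₁v := h₁.w_hasValue
  have w₂v := h₂.w_hasValue
  have hMv : v.HasValue M 1 := by
    rw [hM]
    exact (((((v.one.sub (hV.a₁.mul z₂v)).sub (hV.a₂.mul (z₂v.pow 2))).sub
      (hV.a₃.mul (w₁v.add w₂v))).sub ((hV.a₄.mul z₂v).mul (w₁v.add w₂v))).sub
      (hV.a₆.mul (((w₁v.pow 2).add (w₁v.mul w₂v)).add (w₂v.pow 2)))).congr rfl (by simp)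
  have hNv : v.HasValue N 0 := by
    rw [hN]
    exact ((((((z₁v.pow 2).add (z₁v.mul z₂v)).add (z₂v.pow 2)).add (hV.a₁.mul w₁v)).add
      ((hV.a₂.mul (z₁v.add z₂v)).mul w₁v)).add (hV.a₄.mul (w₁v.pow 2))).congr rfl (by simp)
  have hM₀ := hMv.ne_zero one_ne_zero
  have hMN : (w₁ - w₂) * M = (z₁ - z₂) * N := by
    rw [hM, hN]
    linear_combination e₁ - e₂
  obtain ⟨ℓ, hℓ⟩ : ∃ ℓ, ℓ = N / M := ⟨_, rfl⟩
  have hℓv : v.HasValue ℓ 0 := hℓ ▸ (hNv.div hMv one_ne_zero).congr rfl (by simp)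
  have hℓw : w₁ - w₂ = ℓ * (z₁ - z₂) := by
    rw [hℓ]
    field_simp
    linear_combination hMN
  have hz : z₁ - z₂ ≠ 0 := by
    intro h
    rw [h, mul_zero, sub_eq_zero] at hℓw
    exact hx (by rw [hℓw, sub_eq_zero.mp h])
  obtain ⟨ν, hν⟩ : ∃ ν, ν = w₁ - ℓ * z₁ := ⟨_, rfl⟩
  have hνz : ν * (z₁ - z₂) = w₁ * w₂ * (z₁ / w₁ - z₂ / w₂) := by
    field_simp
    rw [hν]
    linear_combination z₁ * hℓw
  have hν₀ : ν ≠ 0 := by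
    apply left_ne_zero_of_mul (b := z₁ - z₂)
    rw [hνz]
    exact mul_ne_zero (mul_ne_zero hw₁ hw₂) (sub_ne_zero.mpr hx)
  have hl₁ : w₁ = ℓ * z₁ + ν := by rw [hν]; ring
  have hl₂ : w₂ = ℓ * z₂ + ν := by rw [hν]; linear_combination -hℓw
  obtain ⟨z₃, w₃, h₃⟩ := exists_collinearNearInfinity hV h₁ h₂ hℓv hν₀ hl₁ hl₂ (by
    apply mul_left_cancel₀ hz
    rw [hl₁] at e₁
    rw [hl₂] at e₂
    linear_combination e₂ - e₁)
  refine ⟨ℓ, ν, z₃, w₃, h₃, ?_, hνz⟩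
  rw [div_eq_div_iff (sub_ne_zero.mpr hx) hν₀]
  apply mul_right_cancel₀ hz
  have hd : (-(1 / w₁) - -(1 / w₂)) * (w₁ * w₂) = w₁ - w₂ := by
    field_simp
    ring
  linear_combination (-(1 / w₁) - -(1 / w₂)) * hνz + (z₁ / w₁ - z₂ / w₂) * (hd + hℓw)

/-- The tangent in the `(z, w)` plane has slope `N / M`, from the partial derivatives. Its intercept
satisfies `νM = -w(2 - a₁z - a₃w)`, while `negY x y - y = (2 - a₁z - a₃w)/w`; so the possibly small
factor cancels, in every characteristic. -/
lemma reduces_double_at_infinity [DecidableEq F] {x y : F} {h : V.Nonsingular x y}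
    (hA : Reduces v (Affine.Point.some x y h) (0 : V'.Point)) (hy : y ≠ V.negY x y) :
    Reduces v (Affine.Point.some x y h + .some x y h) (0 : V'.Point) ∧
      v.HasValue ((V.negY x y - y) * zCoord (Affine.Point.some x y h) ^ 4 /
        zCoord (Affine.Point.some x y h + .some x y h)) 1 := by
  obtain ⟨z, w, hzw, rfl, rfl, hz⟩ := exists_isNearInfinity hA
  have hw₀ := hzw.w_ne_zero
  have e := hzw.eqn
  have zv := hzw.z_hasValue
  have wv := hzw.w_hasValue
  obtain ⟨M, hM⟩ : ∃ M, M = 1 - V.a₁ * z - V.a₂ * z ^ 2 - 2 * V.a₃ * w -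
    2 * V.a₄ * z * w - 3 * V.a₆ * w ^ 2 := ⟨_, rfl⟩
  obtain ⟨N, hN⟩ : ∃ N, N = 3 * z ^ 2 + V.a₁ * w + 2 * V.a₂ * z * w + V.a₄ * w ^ 2 := ⟨_, rfl⟩
  have hMv : v.HasValue M 1 := by
    rw [hM]
    exact (((((v.one.sub (hV.a₁.mul zv)).sub (hV.a₂.mul (zv.pow 2))).sub
      (((v.ofNat 2).mul hV.a₃).mul wv)).sub ((((v.ofNat 2).mul hV.a₄).mul zv).mul wv)).sub
      (((v.ofNat 3).mul hV.a₆).mul (wv.pow 2))).congr rfl (by simp)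
  have hNv : v.HasValue N 0 := by
    rw [hN]
    exact (((((v.ofNat 3).mul (zv.pow 2)).add (hV.a₁.mul wv)).add
      ((((v.ofNat 2).mul hV.a₂).mul zv).mul wv)).add (hV.a₄.mul (wv.pow 2))).congr rfl (by simp)
  have hM₀ := hMv.ne_zero one_ne_zero
  obtain ⟨ℓ, hℓ⟩ : ∃ ℓ, ℓ = N / M := ⟨_, rfl⟩
  have hℓv : v.HasValue ℓ 0 := hℓ ▸ (hNv.div hMv one_ne_zero).congr rfl (by simp)
  obtain ⟨ν, hν⟩ : ∃ ν, ν = w - ℓ * z := ⟨_, rfl⟩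
  have hℓM : ℓ * M = N := by rw [hℓ]; field_simp
  have hνM : ν * M = -(w * (2 - V.a₁ * z - V.a₃ * w)) := by
    rw [hν, sub_mul, mul_right_comm, hℓM, hM, hN]
    linear_combination 3 * e
  have hyy : V.negY (z / w) (-(1 / w)) - -(1 / w) = (2 - V.a₁ * z - V.a₃ * w) / w := by
    rw [hzw.negY_eq]
    field_simp
    ring
  have hy₀ : 2 - V.a₁ * z - V.a₃ * w ≠ 0 := by
    intro h₀
    rw [h₀, zero_div, sub_eq_zero] at hyy
    exact hy hyy.symm
  have hν₀ : ν ≠ 0 := by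
    apply left_ne_zero_of_mul (b := M)
    rw [hνM]
    exact neg_ne_zero.mpr (mul_ne_zero hw₀ hy₀)
  have hl : w = ℓ * z + ν := by rw [hν]; ring
  obtain ⟨z₃, w₃, h₃⟩ := exists_collinearNearInfinity hV hzw hzw hℓv hν₀ hl hl (by
    rw [hM, hN, hl] at hℓM
    linear_combination -hℓM)
  have hs : V.slope (z / w) (z / w) (-(1 / w)) (-(1 / w)) = ℓ / ν := by
    have hd : -(1 / w) - V.negY (z / w) (-(1 / w)) = -((2 - V.a₁ * z - V.a₃ * w) / w) := by
      rw [← hyy]; ring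
    rw [V.slope_of_Y_ne rfl hy, hd]
    have : ℓ / ν = -(N / (w * (2 - V.a₁ * z - V.a₃ * w))) := by
      rw [← hℓM, eq_neg_iff_add_eq_zero, div_add_div _ _ hν₀ (mul_ne_zero hw₀ hy₀), div_eq_zero_iff]
      left
      linear_combination ℓ * hνM
    rw [this, hN]
    field_simp
    ring
  have key := reduces_add_of_collinear hV (h₁ := h) (h₂ := h) (fun h => hy h.2) h₃ rfl rfl rfl hs
  refine ⟨key.1, ?_⟩
  rw [key.2.1, hz, hyy]
  have hδ := h₃.near₃.neg_denom_hasValue hV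
  have hδ₀ := hδ.ne_zero one_ne_zero
  have hz₀ := hzw.z_ne_zero hV
  have hz₃ := h₃.near₃.z_ne_zero hV
  refine (((((hzw.cube_div_hasValue hV).pow 2).mul hMv).mul hδ).div (h₃.prod_hasValue hV)
    one_ne_zero).congr ?_ (by simp)
  generalize 1 - V.a₁ * z₃ - V.a₃ * w₃ = δ at *
  field_simp
  linear_combination hνM

/-- Two lines are used, through `P₁, P₂` and through `P₁, -P₂`. The first gives `x₁ - x₂ = ν(z₁ -
z₂)/(w₁w₂)` and `ν ~ z₁z₂z₃`, where `z₃ ~ -z(P₁ + P₂)`; the second gives `z₂ - z₁ ~ z(P₂ - P₁)`.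
With `wᵢ ~ zᵢ³` everything cancels. -/
lemma chord_at_infinity [DecidableEq F] {h₁ : V.Nonsingular x₁ y₁} {h₂ : V.Nonsingular x₂ y₂}
    (hx : x₁ ≠ x₂) (hA : Reduces v (Affine.Point.some x₁ y₁ h₁) (0 : V'.Point))
    (hB : Reduces v (Affine.Point.some x₂ y₂ h₂) (0 : V'.Point)) :
    Reduces v (Affine.Point.some x₁ y₁ h₁ + .some x₂ y₂ h₂) (0 : V'.Point) ∧
      Reduces v (Affine.Point.some x₂ y₂ h₂ - .some x₁ y₁ h₁) (0 : V'.Point) ∧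
      v.HasValue ((x₁ - x₂) * zCoord (Affine.Point.some x₁ y₁ h₁) ^ 2 *
        zCoord (Affine.Point.some x₂ y₂ h₂) ^ 2 /
          (zCoord (Affine.Point.some x₁ y₁ h₁ + .some x₂ y₂ h₂) *
            zCoord (Affine.Point.some x₂ y₂ h₂ - .some x₁ y₁ h₁))) 1 := by
  obtain ⟨z₁, w₁, hzw₁, rfl, rfl, hz₁⟩ := exists_isNearInfinity hA
  obtain ⟨z₂, w₂, hzw₂, rfl, rfl, hz₂⟩ := exists_isNearInfinity hB
  obtain ⟨ℓ, ν, z₃, w₃, h, hs, hν⟩ := exists_collinear_chord hV hzw₁ hzw₂ hx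
  have key := reduces_add_of_collinear hV (h₁ := h₁) (h₂ := h₂) (fun h => hx h.1) h rfl rfl rfl hs
  have hδ₂ := hzw₂.neg_denom_hasValue hV
  have hδ₂' := hδ₂.ne_zero one_ne_zero
  have hw₁ := hzw₁.w_ne_zero
  have hw₂ := hzw₂.w_ne_zero
  have hx₂ : -(z₂ / (1 - V.a₁ * z₂ - V.a₃ * w₂)) / -(w₂ / (1 - V.a₁ * z₂ - V.a₃ * w₂)) =
      z₂ / w₂ := by rw [neg_div_neg_eq, div_div_div_cancel_right₀ hδ₂']
  have hy₂ : -(1 / -(w₂ / (1 - V.a₁ * z₂ - V.a₃ * w₂))) = V.negY (z₂ / w₂) (-(1 / w₂)) := by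
    rw [hzw₂.negY_eq]
    field_simp
  obtain ⟨ℓ', ν', z₃', w₃', h', hs', -⟩ :=
    exists_collinear_chord hV hzw₁ (hzw₂.neg hV) (by rwa [hx₂])
  rw [hx₂, hy₂] at hs'
  have key' := reduces_add_of_collinear hV (h₁ := h₁) (h₂ := (Affine.nonsingular_neg ..).mpr h₂)
    (fun h => hx h.1) h' rfl rfl hx₂.symm hs'
  rw [← Affine.Point.neg_some h₂, ← sub_eq_add_neg, neg_sub] at key'
  refine ⟨key.1, ?_, ?_⟩
  · have := reduces_neg hV key'.1
    rwa [neg_sub] at this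
  rw [key.2.1, key'.2.2, hz₁, hz₂]
  have hδ₃ := h.near₃.neg_denom_hasValue hV
  have hκ := h'.rotate.sum_hasValue hV
  have hxx : z₁ / w₁ - z₂ / w₂ = ν * (z₁ - z₂) / (w₁ * w₂) := by
    rw [hν]
    field_simp
  have hκ' : v.HasValue ((z₂ - z₁) / z₃') 1 := by
    refine (hδ₂.mul hκ).congr ?_ (by simp)
    rw [mul_div_assoc']
    congr 1
    obtain ⟨δ, hδ⟩ : ∃ δ, δ = 1 - V.a₁ * z₂ - V.a₃ * w₂ := ⟨_, rfl⟩
    rw [← hδ] at hδ₂' ⊢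
    field_simp
    linear_combination -z₁ * hδ
  rw [hxx]
  refine ((((hκ'.mul (hzw₁.cube_div_hasValue hV)).mul (hzw₂.cube_div_hasValue hV)).mul hδ₃).div
    (h.prod_hasValue hV) one_ne_zero).congr ?_ (by simp)
  generalize 1 - V.a₁ * z₃ - V.a₃ * w₃ = δ at *
  field_simp
  ring

end FormalAdd

/-! ### Local form of the sigma identity and of its doubling analogue -/

section Chord

variable {K F L : Type*} [Field K] [Field F] [Field L] [Algebra K F] [Algebra K L]
  {v : ValueRel K F L} {V : Affine F} {V' : Affine L}

/-- The slope has a simple pole in `z`, so the first-order term of `X - x₁` contributes to the limit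
of `Y` and must be computed. -/
lemma reduces_add_near_infinity (hV : CurveReduces v V V') [DecidableEq F] {x₁ y₁ x₂ y₂ : F}
    {h₁ : V.Nonsingular x₁ y₁} {h₂ : V.Nonsingular x₂ y₂} {x₁' y₁' : L}
    {h₁' : V'.Nonsingular x₁' y₁'} (hx : x₁ ≠ x₂)
    (hA : Reduces v (Affine.Point.some x₁ y₁ h₁) (Affine.Point.some x₁' y₁' h₁'))
    (hB : Reduces v (Affine.Point.some x₂ y₂ h₂) (0 : V'.Point)) :
    Reduces v (Affine.Point.some x₁ y₁ h₁ + .some x₂ y₂ h₂)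
      (Affine.Point.some x₁' y₁' h₁') := by
  obtain ⟨z, w, hzw, rfl, rfl, -⟩ := exists_isNearInfinity hB
  obtain ⟨hx₁, hy₁⟩ := hA
  have hw₀ := hzw.w_ne_zero
  have hz₀ := hzw.z_ne_zero hV
  have hz := hzw.z_hasValue
  obtain ⟨D, E, hD, hwD, hE, hDE⟩ := hzw.exists_mul_eq hV
  have hx₂ : z / w = D / z ^ 2 := by
    rw [div_eq_div_iff hw₀ (pow_ne_zero 2 hz₀)]
    linear_combination -hwD
  have hy₂ : -(1 / w) = -(D / z ^ 3) := by
    rw [neg_inj, div_eq_div_iff hw₀ (pow_ne_zero 3 hz₀)]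
    linear_combination -hwD
  obtain ⟨p, hp⟩ : ∃ p, p = y₁ * z ^ 3 + D := ⟨_, rfl⟩
  obtain ⟨q, hq⟩ : ∃ q, q = x₁ * z ^ 2 - D := ⟨_, rfl⟩
  have hpv : v.HasValue p 1 := hp ▸ ((hy₁.mul (hz.pow 3)).add hD).congr rfl (by simp)
  have hqv : v.HasValue q (-1) := hq ▸ ((hx₁.mul (hz.pow 2)).sub hD).congr rfl (by simp)
  have hq₀ := hqv.ne_zero (by simp)
  have hs : V.slope x₁ (z / w) y₁ (-(1 / w)) = p / (z * q) := by
    have hx' := sub_ne_zero.mpr hx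
    rw [V.slope_of_X_ne hx, div_eq_div_iff hx' (mul_ne_zero hz₀ hq₀), hx₂, hy₂, hp, hq]
    field_simp
    ring
  -- `T` is what remains of the numerator of `X - x₁` after dividing by `z³`. Its value `2y₁' +
  -- a₁x₁' + a₃` is what makes the third point of the line tend to the negative of the limit point.
  obtain ⟨T, hT⟩ : ∃ T, T = D ^ 2 * E + 2 * D * y₁ + y₁ ^ 2 * z ^ 3 +
    V.a₁ * (x₁ * D - D * y₁ * z + x₁ * y₁ * z ^ 3) + D * x₁ ^ 2 * z + 2 * (V.a₂ + x₁) * D * x₁ * z -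
    (V.a₂ + x₁) * x₁ ^ 2 * z ^ 3 - x₁ ^ 3 * z ^ 3 := ⟨_, rfl⟩
  have hTv : v.HasValue T (2 * y₁' + V'.a₁ * x₁' + V'.a₃) := by
    rw [hT]
    have ha := hV.a₂.add hx₁
    refine ((((((((hD.pow 2).mul hE).add (((v.ofNat 2).mul hD).mul hy₁)).add
      ((hy₁.pow 2).mul (hz.pow 3))).add (hV.a₁.mul (((hx₁.mul hD).sub ((hD.mul hy₁).mul hz)).add
      ((hx₁.mul hy₁).mul (hz.pow 3))))).add ((hD.mul (hx₁.pow 2)).mul hz)).add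
      (((((v.ofNat 2).mul ha).mul hD).mul hx₁).mul hz)).sub
      ((ha.mul (hx₁.pow 2)).mul (hz.pow 3))).sub ((hx₁.pow 3).mul (hz.pow 3)) |>.congr rfl ?_
    ring
  have hX : V.addX x₁ (z / w) (p / (z * q)) = x₁ + z * T / q ^ 2 := by
    suffices p ^ 2 + V.a₁ * z * p * q - ((V.a₂ + 2 * x₁) * z ^ 2 + D) * q ^ 2 = z ^ 3 * T by
      rw [Affine.addX, hx₂]
      field_simp
      linear_combination this
    rw [hp, hq, hT]
    linear_combination (-D ^ 2) * hDE
  have hXv : v.HasValue (V.addX x₁ (z / w) (p / (z * q))) x₁' := by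
    rw [hX]
    exact (hx₁.add ((hz.mul hTv).div (hqv.pow 2) (by simp))).congr rfl (by simp)
  have hYv : v.HasValue (V.negAddY x₁ (z / w) y₁ (p / (z * q))) (V'.negY x₁' y₁') := by
    rw [Affine.negAddY, hX, add_sub_cancel_left]
    refine (((hpv.mul hTv).div (hqv.pow 3) (by simp)).add hy₁).congr ?_ ?_
    · field_simp
    · rw [Affine.negY]
      norm_num
      ring
  rw [Affine.Point.add_some fun h => hx h.1]
  refine ⟨hs ▸ hXv, ?_⟩
  rw [hs]
  exact (negY_hasValue hV hXv hYv).congr rfl (Affine.negY_negY ..)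

/-- The `x`-coordinate of a point (with the dummy value `0` at infinity). -/
def xCoord {L : Type*} [Field L] {V : Affine L} : V.Point → L
  | .zero => 0
  | .some x _ _ => x

open Classical in
/-- A local equation of the pullback of `(𝓞)` along the point `A`, which reduces to `A'`. -/
noncomputable def localParam (A : V.Point) (A' : V'.Point) : F := if A' = 0 then zCoord A else 1

lemma localParam_zero (A : V.Point) : localParam A (0 : V'.Point) = zCoord A := if_pos rfl

lemma localParam_of_ne_zero (A : V.Point) {A' : V'.Point} (h : A' ≠ 0) : localParam A A' = 1 :=
  if_neg h

open Classical in
/-- The value of the normalized difference of the `x`-coordinates of two points which reduce to the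
given points. -/
noncomputable def chordValue : V'.Point → V'.Point → L
  | .zero, _ => 1
  | .some _ _ _, .zero => -1
  | .some x₁ y₁ _, .some x₂ y₂ _ =>
    if x₁ = x₂ then
      if y₁ = V'.negY x₁ y₁ then -(3 * x₁ ^ 2 + 2 * V'.a₂ * x₁ + V'.a₄ - V'.a₁ * y₁)
      else if y₁ = y₂ then V'.negY x₁ y₁ - y₁ else y₁ - V'.negY x₁ y₁
    else x₁ - x₂

lemma chordValue_ne_zero (A' B' : V'.Point) : chordValue A' B' ≠ 0 := by
  rcases A' with _ | ⟨x₁, y₁, h₁⟩ <;> rcases B' with _ | ⟨x₂, y₂, h₂⟩ <;> simp only [chordValue]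
  iterate 3 simp
  split_ifs with hx hy hy'
  · exact neg_ne_zero.mpr (tangent_ne_zero h₁ hy)
  · exact sub_ne_zero.mpr (Ne.symm hy)
  · exact sub_ne_zero.mpr hy
  · exact sub_ne_zero.mpr hx

lemma chordValue_neg {A' B' : V'.Point} (h : B' ≠ A') (h' : B' ≠ -A') :
    chordValue A' (-B') = chordValue A' B' := by
  rcases A' with _ | ⟨x₁, y₁, h₁⟩ <;> rcases B' with _ | ⟨x₂, y₂, h₂⟩
  iterate 3 rfl
  have hx : x₁ ≠ x₂ := fun hx =>
    (Affine.Point.X_eq_iff.mp hx).elim (fun e => h e.symm) fun e => h' (by rw [e, neg_neg])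
  simp only [Affine.Point.neg_some, chordValue, if_neg hx]

lemma chordValue_neg_self {A' : V'.Point} (h : A' ≠ 0) (h' : A' ≠ -A') :
    chordValue A' (-A') = -chordValue A' A' := by
  rcases A' with _ | ⟨x, y, hA⟩
  · exact (h rfl).elim
  have hy : y ≠ V'.negY x y := fun hy => h' (by simpa using hy)
  simp only [Affine.Point.neg_some, chordValue, if_neg hy, if_true, neg_sub]

lemma chordValue_zero {A' : V'.Point} (h : A' ≠ 0) : chordValue A' 0 = -1 := by
  rcases A' with _ | ⟨x, y, hA⟩
  · exact (h rfl).elim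
  · rfl

lemma div_hasValue_of_slope {a d ζ : F} {c : L} (hs : a / d ≠ 0)
    (hζ : v.HasValue (a / d * ζ) 1) (ha : v.HasValue a c) : v.HasValue (d / ζ) c := by
  obtain ⟨h₂, h₃⟩ := div_ne_zero_iff.mp hs
  refine (ha.div hζ one_ne_zero).congr ?_ (by simp)
  field_simp

/-- The case where sum and difference both tend to `𝓞`: `ζ` and `ξ` are asymptotic to the inverses
of the slopes `a/d` and `b/(-d)`, whose product is `-N/d`. -/
lemma div_hasValue_of_slopes {a b d ζ ξ N : F} {c : L} (hs : a / d ≠ 0)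
    (hζ : v.HasValue (a / d * ζ) 1) (hs' : b / -d ≠ 0) (hξ : v.HasValue (b / -d * ξ) 1)
    (hN : a * b = d * N) (hc : v.HasValue N c) : v.HasValue (d / (ζ * ξ)) (-c) := by
  have h₁ := right_ne_zero_of_mul (hζ.ne_zero one_ne_zero)
  have h₂ := right_ne_zero_of_mul (hξ.ne_zero one_ne_zero)
  obtain ⟨h₃, h₄⟩ := div_ne_zero_iff.mp hs
  obtain ⟨h₅, h₆⟩ := div_ne_zero_iff.mp hs'
  refine (hc.neg.div (hζ.mul hξ) (by simp)).congr ?_ (by simp)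
  field_simp
  linear_combination -hN

/-- The `y`-coordinate of a point (with the dummy value `0` at infinity). -/
def yCoord {L : Type*} [Field L] {V : Affine L} : V.Point → L
  | .zero => 0
  | .some _ y _ => y

variable [DecidableEq F] [DecidableEq L] (hV : CurveReduces v V V')

include hV in
-- The cases are `A' = B'` of order two, `A' = B'` otherwise, `A' = -B'`, and distinct
-- `x`-coordinates. When the sum or difference tends to `𝓞`, its `z`-coordinate is asymptotic to the
-- inverse of a slope with denominator `±(x₁ - x₂)`, which cancels the zero of `x₁ - x₂`.
lemma chord_affine {x₁ y₁ x₂ y₂ : F} {x₁' y₁' x₂' y₂' : L} {h₁ : V.Nonsingular x₁ y₁}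
    {h₂ : V.Nonsingular x₂ y₂} {h₁' : V'.Nonsingular x₁' y₁'} {h₂' : V'.Nonsingular x₂' y₂'}
    (hx : x₁ ≠ x₂) (hA : Reduces v (Affine.Point.some x₁ y₁ h₁) (Affine.Point.some x₁' y₁' h₁'))
    (hB : Reduces v (Affine.Point.some x₂ y₂ h₂) (Affine.Point.some x₂' y₂' h₂')) :
    Reduces v (Affine.Point.some x₁ y₁ h₁ + .some x₂ y₂ h₂)
      (Affine.Point.some x₁' y₁' h₁' + .some x₂' y₂' h₂') ∧
    Reduces v (Affine.Point.some x₂ y₂ h₂ - .some x₁ y₁ h₁)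
      (Affine.Point.some x₂' y₂' h₂' - .some x₁' y₁' h₁') ∧
    v.HasValue ((x₁ - x₂) / (localParam (Affine.Point.some x₁ y₁ h₁ + .some x₂ y₂ h₂)
        (Affine.Point.some x₁' y₁' h₁' + .some x₂' y₂' h₂') *
      localParam (Affine.Point.some x₂ y₂ h₂ - .some x₁ y₁ h₁)
        (Affine.Point.some x₂' y₂' h₂' - .some x₁' y₁' h₁')))
      (chordValue (Affine.Point.some x₁' y₁' h₁') (Affine.Point.some x₂' y₂' h₂')) := by
  obtain ⟨hx₁, hy₁⟩ := hA
  obtain ⟨hx₂, hy₂⟩ := hB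
  have hn₁ := negY_hasValue hV hx₁ hy₁
  obtain ⟨r, hr⟩ := reduces_add_of_affine hV (h₁ := h₁) (h₂ := h₂) (h₁' := h₁') (h₂' := h₂')
    hx hx₁ hy₁ hx₂ hy₂
  obtain ⟨s, hs⟩ := reduces_add_of_affine hV (h₁ := h₂) (h₂ := (Affine.nonsingular_neg ..).mpr h₁)
    (h₁' := h₂') (h₂' := (Affine.nonsingular_neg ..).mpr h₁') hx.symm hx₂ hy₂ hx₁ hn₁
  rw [← Affine.Point.neg_some h₁, ← Affine.Point.neg_some h₁', ← sub_eq_add_neg,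
    ← sub_eq_add_neg] at s
  rw [← Affine.Point.neg_some h₁, ← sub_eq_add_neg, Affine.negY_negY] at hs
  refine ⟨r, s, ?_⟩
  have zr (h : x₁' = x₂' ∧ y₁' = V'.negY x₂' y₂') :
      localParam (Affine.Point.some x₁ y₁ h₁ + .some x₂ y₂ h₂)
        (Affine.Point.some x₁' y₁' h₁' + .some x₂' y₂' h₂') =
          zCoord (Affine.Point.some x₁ y₁ h₁ + .some x₂ y₂ h₂) := by
    rw [Affine.Point.add_of_Y_eq h.1 h.2, localParam_zero]
  have nr (h : ¬(x₁' = x₂' ∧ y₁' = V'.negY x₂' y₂')) :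
      localParam (Affine.Point.some x₁ y₁ h₁ + .some x₂ y₂ h₂)
        (Affine.Point.some x₁' y₁' h₁' + .some x₂' y₂' h₂') = 1 := by
    rw [Affine.Point.add_some h, localParam_of_ne_zero _ (Affine.Point.some_ne_zero _)]
  have zs (h : x₁' = x₂' ∧ y₁' = y₂') :
      localParam (Affine.Point.some x₂ y₂ h₂ - .some x₁ y₁ h₁)
        (Affine.Point.some x₂' y₂' h₂' - .some x₁' y₁' h₁') =
          zCoord (Affine.Point.some x₂ y₂ h₂ - .some x₁ y₁ h₁) := by
    obtain ⟨rfl, rfl⟩ := h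
    rw [sub_self, localParam_zero]
  have ns (h : ¬(x₁' = x₂' ∧ y₁' = y₂')) :
      localParam (Affine.Point.some x₂ y₂ h₂ - .some x₁ y₁ h₁)
        (Affine.Point.some x₂' y₂' h₂' - .some x₁' y₁' h₁') = 1 := by
    rw [localParam_of_ne_zero]
    rw [sub_ne_zero, Ne, Affine.Point.some.injEq]
    exact fun e => h ⟨e.1.symm, e.2.symm⟩
  simp only [chordValue]
  split_ifs with hxx hyn hyy
  · obtain rfl := hxx
    obtain rfl : y₁' = y₂' := by
      rcases Affine.Y_eq_of_X_eq h₁'.1 h₂'.1 rfl with h | h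
      · exact h
      · rw [hyn, h, Affine.negY_negY]
    rw [zr ⟨rfl, hyn⟩, zs ⟨rfl, rfl⟩]
    obtain ⟨hr₀, hr⟩ := hr ⟨rfl, hyn⟩
    obtain ⟨hs₀, hs⟩ := hs ⟨rfl, rfl⟩
    rw [← neg_sub x₁ x₂] at hs₀ hs
    refine div_hasValue_of_slopes hr₀ hr hs₀ hs ?_ (chord_numerator_hasValue hV hx₂ hy₂ hx₁)
    linear_combination -chord_mul_eq h₂.1 h₁.1
  · obtain rfl := hxx
    subst hyy
    rw [nr fun h => hyn h.2, zs ⟨rfl, rfl⟩, one_mul]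
    obtain ⟨hs₀, hs⟩ := hs ⟨rfl, rfl⟩
    refine (div_hasValue_of_slope hs₀ hs (hy₂.sub hn₁)).neg.congr ?_ (by ring)
    rw [← neg_div, neg_sub]
  · obtain rfl := hxx
    have hyn' : y₁' = V'.negY x₁' y₂' := by
      rcases Affine.Y_eq_of_X_eq h₁'.1 h₂'.1 rfl with h | h
      · exact (hyy h).elim
      · exact h
    rw [ns fun h => hyy h.2, zr ⟨rfl, hyn'⟩, mul_one]
    obtain ⟨hr₀, hr⟩ := hr ⟨rfl, hyn'⟩
    refine (div_hasValue_of_slope hr₀ hr (hy₁.sub hy₂)).congr rfl ?_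
    rw [hyn', Affine.negY_negY]
  · rw [nr fun h => hxx h.1, ns fun h => hxx h.1, mul_one, div_one]
    exact hx₁.sub hx₂

include hV in
/-- The local behaviour of the identity `σ(A + B) σ(B - A) = σ(A)² σ(B)² (x(A) - x(B))`. -/
theorem chord {A B : V.Point} {A' B' : V'.Point} (hA : Reduces v A A') (hB : Reduces v B B')
    (hAB : xCoord A ≠ xCoord B) (h₀ : A' = 0 → B' = 0) :
    Reduces v (A + B) (A' + B') ∧ Reduces v (B - A) (B' - A') ∧
      v.HasValue ((xCoord A - xCoord B) * localParam A A' ^ 2 * localParam B B' ^ 2 /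
        (localParam (A + B) (A' + B') * localParam (B - A) (B' - A'))) (chordValue A' B') := by
  rcases A with _ | ⟨x₁, y₁, h₁⟩
  · exact hA.elim
  rcases B with _ | ⟨x₂, y₂, h₂⟩
  · exact hB.elim
  simp only [xCoord] at hAB ⊢
  rcases A' with _ | ⟨x₁', y₁', h₁'⟩
  -- The hypothesis `h₀` excludes `A' = 0 ≠ B'`; it holds in the application, where `B` is a
  -- multiple of `A`.
  · obtain rfl := h₀ rfl
    have := chord_at_infinity hV hAB hA hB
    rw [← Affine.Point.zero_def, add_zero, sub_zero]
    simp only [localParam_zero]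
    exact this
  rcases B' with _ | ⟨x₂', y₂', h₂'⟩
  · have r := reduces_add_near_infinity hV hAB hA hB
    have hB' := reduces_neg hV hB
    rw [Affine.Point.neg_some] at hB'
    have s := reduces_neg hV (reduces_add_near_infinity hV hAB hA hB')
    rw [← Affine.Point.neg_some h₂, ← sub_eq_add_neg, neg_sub] at s
    have h₁₀ := Affine.Point.some_ne_zero h₁'
    rw [← Affine.Point.zero_def, add_zero, zero_sub]
    refine ⟨r, s, ?_⟩
    rw [localParam_of_ne_zero _ h₁₀, localParam_of_ne_zero _ h₁₀,
      localParam_of_ne_zero _ (neg_ne_zero.mpr h₁₀), localParam_zero, chordValue_zero h₁₀]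
    obtain ⟨hx₁, -⟩ := hA
    obtain ⟨z, w, hzw, rfl, rfl, hz⟩ := exists_isNearInfinity hB
    rw [hz]
    refine ((hx₁.mul (hzw.z_hasValue.pow 2)).sub (hzw.cube_div_hasValue hV)).congr ?_ (by simp)
    field_simp
  · have := chord_affine hV hAB hA hB
    simpa only [localParam_of_ne_zero _ (Affine.Point.some_ne_zero h₁'),
      localParam_of_ne_zero _ (Affine.Point.some_ne_zero h₂'), one_pow, mul_one] using this

include hV in
/-- The doubling analogue of `chord`. -/
theorem tangent {A : V.Point} {A' : V'.Point} (hA : Reduces v A A') (hAA : A + A ≠ 0) :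
    Reduces v (A + A) (A' + A') ∧ ∃ c, c ≠ 0 ∧ (A' = 0 → c = 1) ∧
      v.HasValue ((yCoord (-A) - yCoord A) * localParam A A' ^ 4 / localParam (A + A) (A' + A'))
        c := by
  rcases A with _ | ⟨x, y, h⟩
  · exact hA.elim
  have hy : y ≠ V.negY x y := fun hy => hAA (Affine.Point.add_self_of_Y_eq hy)
  rcases A' with _ | ⟨x', y', h'⟩
  · have := reduces_double_at_infinity hV hA hy
    rw [← Affine.Point.zero_def, add_zero]
    refine ⟨this.1, 1, one_ne_zero, fun _ => rfl, ?_⟩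
    simp only [localParam_zero]
    exact this.2
  obtain ⟨hx, hyv⟩ := hA
  have hn := negY_hasValue hV hx hyv
  have hN : v.HasValue (3 * x ^ 2 + 2 * V.a₂ * x + V.a₄ - V.a₁ * y)
      (3 * x' ^ 2 + 2 * V'.a₂ * x' + V'.a₄ - V'.a₁ * y') :=
    (chord_numerator_hasValue hV hx hyv hx).congr (by ring) rfl
  have hs := V.slope_of_Y_ne rfl hy
  rw [localParam_of_ne_zero _ (Affine.Point.some_ne_zero h'), one_pow, mul_one]
  simp only [Affine.Point.neg_some, yCoord]
  by_cases hy' : y' = V'.negY x' y'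
  · have hN₀ := tangent_ne_zero h' hy'
    have hs₀ : V.slope x x y y ≠ 0 := by
      rw [hs]
      exact div_ne_zero (hN.ne_zero hN₀) (sub_ne_zero.mpr hy)
    have := reduces_add_of_inv_slope hV (h₁ := h) (h₂ := h) (fun h => hy h.2) hx hyv hx hs₀ (by
      rw [hs, inv_div]
      exact ((hyv.sub hn).div hN hN₀).congr rfl (by rw [← hy', sub_self, zero_div]))
    rw [Affine.Point.add_self_of_Y_eq hy', localParam_zero]
    refine ⟨this.1, _, neg_ne_zero.mpr hN₀, fun h => (Affine.Point.some_ne_zero h' h).elim, ?_⟩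
    rw [hs] at this hs₀
    refine (div_hasValue_of_slope hs₀ this.2 hN).neg.congr ?_ rfl
    rw [← neg_div, neg_sub]
  · refine ⟨reduces_add_of_slope hV (fun h => hy h.2) (fun h => hy' h.2) hx hyv hx ?_,
      V'.negY x' y' - y', sub_ne_zero.mpr (Ne.symm hy'),
      fun h => (Affine.Point.some_ne_zero h' h).elim, ?_⟩
    · rw [hs, V'.slope_of_Y_ne rfl hy']
      exact hN.div (hyv.sub hn) (sub_ne_zero.mpr hy')
    · rw [Affine.Point.add_self_of_Y_ne hy', localParam_of_ne_zero _ (Affine.Point.some_ne_zero _),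
        div_one]
      exact hn.sub hyv

end Chord

/-! ### Functions without affine zeros and poles -/

section Units

variable {K : Type*} [Field K] {W : Affine K}

lemma algHom_mk {A : Type*} [CommRing A] [Algebra K A] (φ : W.CoordinateRing →ₐ[K] A)
    (H : K[X][Y]) : φ (Affine.CoordinateRing.mk W H) =
      aevalAeval (φ (Affine.CoordinateRing.mk W (C X))) (φ (Affine.CoordinateRing.mk W Y)) H := by
  let ψ : K[X][Y] →ₐ[K] A :=
    { φ.toRingHom.comp (Affine.CoordinateRing.mk W) with commutes' := fun a => φ.commutes a }
  change ψ H = _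
  congr 1
  apply (aevalAevalEquiv K A).symm.injective
  rw [Equiv.symm_apply_apply]
  rfl

instance : Algebra.FiniteType K W.CoordinateRing :=
  haveI : Algebra.FiniteType K K[X][Y] := .trans (S := K[X]) inferInstance inferInstance
  .of_surjective (AlgHom.mk (Affine.CoordinateRing.mk W) fun _ => rfl) AdjoinRoot.mk_surjective

/-- The Nullstellensatz: maximal ideals of the coordinate ring come from geometric points. -/
lemma exists_algHom_ker_eq (M : Ideal W.CoordinateRing) [hM : M.IsMaximal] :
    ∃ φ : W.CoordinateRing →ₐ[K] AlgebraicClosure K, RingHom.ker φ = M := by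
  let := Ideal.Quotient.field M
  have : Module.Finite K (W.CoordinateRing ⧸ M) := finite_of_finite_type_of_isJacobsonRing ..
  have : Algebra.IsAlgebraic K (W.CoordinateRing ⧸ M) := Algebra.IsAlgebraic.of_finite ..
  let ψ : W.CoordinateRing ⧸ M →ₐ[K] AlgebraicClosure K := IsAlgClosed.lift
  refine ⟨ψ.comp (Ideal.Quotient.mkₐ K M), ?_⟩
  ext a
  rw [RingHom.mem_ker, AlgHom.comp_apply, map_eq_zero]
  exact Ideal.Quotient.eq_zero_iff_mem

variable [W.IsElliptic]

/-- If the ideal of denominators of `f` were proper, it would vanish at some geometric point; but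
regularity there provides a denominator that does not. -/
lemma exists_eq_algebraMap_of_regular {f : W.FunctionField}
    (h : ∀ Q : (W.baseChange (AlgebraicClosure K)).Point, Q ≠ 0 →
      ∃ c, (pointRel W Q).HasValue f c) :
    ∃ a : W.CoordinateRing, algebraMap _ _ a = f := by
  let I : Ideal W.CoordinateRing :=
    { carrier := {b | ∃ a : W.CoordinateRing, algebraMap _ _ a = algebraMap _ _ b * f}
      zero_mem' := ⟨0, by simp⟩
      add_mem' := by
        rintro b b' ⟨a, ha⟩ ⟨a', ha'⟩
        exact ⟨a + a', by rw [map_add, map_add, add_mul, ha, ha']⟩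
      smul_mem' := by
        rintro d b ⟨a, ha⟩
        exact ⟨d * a, by rw [smul_eq_mul, map_mul, map_mul, ha, mul_assoc]⟩ }
  suffices I = ⊤ by
    obtain ⟨a, ha⟩ := (Ideal.eq_top_iff_one I).mp this
    exact ⟨a, by rw [ha, map_one, one_mul]⟩
  by_contra hI
  obtain ⟨M, hM, hIM⟩ := Ideal.exists_le_maximal I hI
  obtain ⟨φ, hφ⟩ := exists_algHom_ker_eq M
  have : (W.baseChange (AlgebraicClosure K)).IsElliptic :=
    inferInstanceAs (WeierstrassCurve.map W (algebraMap K (AlgebraicClosure K))).IsElliptic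
  have hQ : (W.baseChange (AlgebraicClosure K)).Equation
      (φ (Affine.CoordinateRing.mk W (C X))) (φ (Affine.CoordinateRing.mk W Y)) := by
    have := algHom_mk φ W.polynomial
    rw [AdjoinRoot.mk_self, map_zero, aevalAeval_polynomial] at this
    exact (Affine.equation_iff' ..).mpr this.symm
  obtain ⟨c, G, H, hH, hf, -⟩ :=
    h (.some _ _ (Affine.equation_iff_nonsingular.mp hQ)) (Affine.Point.some_ne_zero _)
  rw [← algHom_mk] at hH
  have hH' : Affine.CoordinateRing.mk W H ≠ 0 := by
    intro h
    rw [h, map_zero] at hH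
    exact hH rfl
  refine hH (RingHom.mem_ker.mp (hφ ▸ hIM ⟨Affine.CoordinateRing.mk W G, ?_⟩))
  rw [hf, aevalAeval_xFun_yFun, aevalAeval_xFun_yFun, mul_div_cancel₀ _ (by simpa using hH')]

/-- A function without zeros and poles in the affine part of the curve is constant. -/
theorem exists_eq_const_of_units {f : W.FunctionField} (hf : f ≠ 0)
    (h : ∀ Q : (W.baseChange (AlgebraicClosure K)).Point, Q ≠ 0 →
      ∃ c, c ≠ 0 ∧ (pointRel W Q).HasValue f c) :
    ∃ c : K, f = algebraMap K _ c := by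
  obtain ⟨a, ha⟩ := exists_eq_algebraMap_of_regular fun Q hQ => (h Q hQ).imp fun _ hc => hc.2
  obtain ⟨b, hb⟩ := exists_eq_algebraMap_of_regular (f := f⁻¹) fun Q hQ =>
    (h Q hQ).elim fun c hc => ⟨c⁻¹, (pointRel W Q).inv hc.2 hc.1⟩
  have hab : a * b = 1 := by
    apply IsFractionRing.injective W.CoordinateRing W.FunctionField
    rw [map_mul, ha, hb, map_one, mul_inv_cancel₀ hf]
  have hd := congr_arg (poleDegree W) hab
  rw [poleDegree_mul, poleDegree_one] at hd
  obtain ⟨p, q, rfl⟩ := Affine.CoordinateRing.exists_smul_basis_eq a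
  -- The pole orders of `a` and of its inverse `b` are natural numbers with sum `0`.
  have hd' : poleDegree W (p • 1 + q • Affine.CoordinateRing.mk W Y) ≤ 0 := by
    rcases h : poleDegree W (p • 1 + q • Affine.CoordinateRing.mk W Y) with _ | d
    · exact bot_le
    rcases h' : poleDegree W b with _ | e <;> rw [h, h'] at hd
    · exact (WithBot.bot_ne_coe hd).elim
    · have : d + e = 0 := WithBot.coe_injective hd
      have : d = 0 := by omega
      rw [this]
      exact le_rfl
  rw [poleDegree_smul_basis, max_le_iff] at hd'
  have hq : q = 0 := by
    by_contra hq
    rw [degree_eq_natDegree hq, nsmul_eq_mul, nsmul_eq_mul] at hd'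
    have : 2 * q.natDegree + 3 ≤ 0 := by exact_mod_cast hd'.2
    omega
  have hp : p.degree ≤ 0 := by
    by_cases hp : p = 0
    · simp [hp]
    rw [degree_eq_natDegree hp, nsmul_eq_mul] at hd'
    rw [degree_eq_natDegree hp]
    have : 2 * p.natDegree ≤ 0 := by exact_mod_cast hd'.1
    have : p.natDegree = 0 := by omega
    simp [this]
  refine ⟨p.coeff 0, ?_⟩
  rw [← ha, hq, zero_smul, add_zero, eq_C_of_degree_le_zero hp, Affine.CoordinateRing.smul, mul_one,
    coeff_C_zero]
  rfl

end Units

/-! ### The recursive division polynomials at a point -/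

section Generic

lemma Reduces.unique {K F L : Type*} [Field K] [Field F] [Field L] [Algebra K F] [Algebra K L]
    {v : ValueRel K F L} {V : Affine F} {V' : Affine L} {A : V.Point} {A' A'' : V'.Point}
    (h : Reduces v A A') (h' : Reduces v A A'') : A' = A'' := by
  rcases A with _ | ⟨x, y, hA⟩
  · exact h.elim
  have aux {d : L} (hy : v.HasValue y d) (h : y ≠ 0 ∧ v.HasValue (-(x / y)) 0 ∧
      v.HasValue (-(1 / y)) 0) : False := by
    have := (hy.mul h.2.2).congr (g := -1) (by field_simp [h.1]) (mul_zero d)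
    exact neg_ne_zero.mpr one_ne_zero (v.one.neg.unique this)
  rcases A' with _ | ⟨x', y', hA'⟩ <;> rcases A'' with _ | ⟨x'', y'', hA''⟩
  · rfl
  · exact (aux h'.2 h).elim
  · exact (aux h.2 h').elim
  · obtain rfl := h.1.unique h'.1
    obtain rfl := h.2.unique h'.2
    rfl

variable {K : Type*} [Field K] (W : Affine K) [W.IsElliptic]

lemma reduces_genericPoint {L : Type*} [Field L] [Algebra K L] (Q : (W.baseChange L).Point) :
    Reduces (pointRel W Q) (genericPoint W) Q := by
  rcases Q with _ | ⟨x, y, h⟩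
  · exact ⟨yFun_ne_zero, chartRel_fst .., chartRel_snd ..⟩
  · exact ⟨chartRel_fst .., chartRel_snd ..⟩

/-- Otherwise `2y + a₁x + a₃ = 0` in the coordinate ring, so `2 = a₁ = a₃ = 0` in `K` and the
discriminant vanishes. -/
lemma yFun_ne_negY : yFun W ≠ (W.baseChange W.FunctionField).negY (xFun W) (yFun W) := by
  intro h
  have h₁ : yFun W - (-yFun W - algebraMap K _ W.a₁ * xFun W - algebraMap K _ W.a₃) = 0 :=
    sub_eq_zero.mpr h
  have h₂ : algebraMap W.CoordinateRing W.FunctionField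
      ((C W.a₁ * X + C W.a₃ : K[X]) • 1 + (2 : K[X]) • Affine.CoordinateRing.mk W Y) = 0 := by
    rw [← h₁, Affine.CoordinateRing.smul, Affine.CoordinateRing.smul]
    simp only [map_add, map_mul, mul_one, map_ofNat, yFun, xFun]
    have hC : ∀ a : K, algebraMap W.CoordinateRing W.FunctionField
      (Affine.CoordinateRing.mk W (C (C a))) = algebraMap K W.FunctionField a := fun a => rfl
    rw [hC, hC]
    ring
  rw [map_eq_zero_iff _ (IsFractionRing.injective _ _)] at h₂
  obtain ⟨hp, hq⟩ := Affine.CoordinateRing.smul_basis_eq_zero h₂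
  have h2 : (2 : K) = 0 := by simpa using congr_arg (eval 0) hq
  have h3 : W.a₃ = 0 := by simpa using congr_arg (eval 0) hp
  have h1 : W.a₁ = 0 := by simpa [h3] using congr_arg (eval 1) hp
  refine W.isUnit_Δ.ne_zero ?_
  rw [WeierstrassCurve.Δ, WeierstrassCurve.b₂, WeierstrassCurve.b₄, WeierstrassCurve.b₆, h1, h3]
  linear_combination (exp := 1) (-8 * (W.a₂ ^ 2 * W.b₈) - 32 * W.a₄ ^ 3 - 216 * W.a₆ ^ 2 +
    144 * W.a₂ * W.a₄ * W.a₆) * h2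

/-- The division polynomials, defined recursively by `F (n + 1) F (n - 1) = F n ² (x - x ∘ [n])`. -/
noncomputable def divFun [DecidableEq W.FunctionField] : ℕ → W.FunctionField
  | 0 => 0
  | 1 => 1
  | 2 => yCoord (-genericPoint W) - yCoord (genericPoint W)
  | n + 3 => divFun (n + 2) ^ 2 * (xFun W - xCoord ((n + 2) • genericPoint W)) / divFun (n + 1)

variable [DecidableEq W.FunctionField] {L : Type*} [Field L] [Algebra K L] [DecidableEq L]

/-- The quotient of the `n`-th division polynomial by a local equation of its divisor. -/
noncomputable def normalizedDivFun (n : ℕ) (Q : (W.baseChange L).Point) : W.FunctionField :=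
  divFun W n * localParam (genericPoint W) Q ^ n ^ 2 / localParam (n • genericPoint W) (n • Q)

/-- The properties of the `n`-th division polynomial at a point. -/
def DivFunRegularAt (n : ℕ) (Q : (W.baseChange L).Point) : Prop :=
  Reduces (pointRel W Q) (n • genericPoint W) (n • Q) ∧ ∃ e, e ≠ 0 ∧ (Q = 0 → e = 1) ∧
    (pointRel W Q).HasValue (normalizedDivFun W n Q) e

variable {W}

lemma normalizedDivFun_one (Q : (W.baseChange L).Point) : normalizedDivFun W 1 Q = 1 := by
  have : localParam (genericPoint W) Q ≠ 0 := by
    by_cases hQ : Q = 0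
    · rw [hQ, localParam_zero]
      exact neg_ne_zero.mpr (div_ne_zero xFun_ne_zero yFun_ne_zero)
    · rw [localParam_of_ne_zero _ hQ]
      exact one_ne_zero
  rw [normalizedDivFun, one_smul, one_smul, divFun, one_pow, pow_one, one_mul, div_self this]

lemma divFunRegularAt_one (Q : (W.baseChange L).Point) : DivFunRegularAt W 1 Q := by
  refine ⟨by simpa using reduces_genericPoint W Q, 1, one_ne_zero, fun _ => rfl, ?_⟩
  rw [normalizedDivFun_one]
  exact (pointRel W Q).one

lemma divFunRegularAt_two (Q : (W.baseChange L).Point) : DivFunRegularAt W 2 Q := by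
  have := tangent (curveReduces_baseChange (pointRel W Q) W) (reduces_genericPoint W Q) (by
    rw [genericPoint, Affine.Point.add_self_of_Y_ne (yFun_ne_negY W)]
    exact Affine.Point.some_ne_zero _)
  rw [DivFunRegularAt, normalizedDivFun, two_smul, two_smul]
  exact this

/-- The recursion for `divFun` multiplied by the local statement `chord` for the generic point and
its multiple. -/
lemma normalizedDivFun_hasValue {n : ℕ} {Q : (W.baseChange L).Point} {c d : L}
    (hn : Reduces (pointRel W Q) ((n + 2) • genericPoint W) ((n + 2) • Q))
    (hx : xFun W ≠ xCoord ((n + 2) • genericPoint W)) (hc₀ : c ≠ 0)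
    (hc : (pointRel W Q).HasValue (normalizedDivFun W (n + 1) Q) c)
    (hd : (pointRel W Q).HasValue (normalizedDivFun W (n + 2) Q) d) :
    Reduces (pointRel W Q) ((n + 3) • genericPoint W) ((n + 3) • Q) ∧
    (pointRel W Q).HasValue (normalizedDivFun W (n + 3) Q)
      (d ^ 2 * chordValue Q ((n + 2) • Q) / c) := by
  obtain ⟨h₁, -, h₃⟩ := chord (curveReduces_baseChange (pointRel W Q) W) (reduces_genericPoint W Q)
    hn hx fun h => by rw [h, smul_zero]
  have e₁ : genericPoint W + (n + 2) • genericPoint W = (n + 3) • genericPoint W := by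
    rw [← succ_nsmul']
  have e₂ : Q + (n + 2) • Q = (n + 3) • Q := by rw [← succ_nsmul']
  have e₃ : (n + 2) • genericPoint W - genericPoint W = (n + 1) • genericPoint W := by
    rw [succ_nsmul _ (n + 1), add_sub_cancel_right]
  have e₄ : (n + 2) • Q - Q = (n + 1) • Q := by
    rw [succ_nsmul _ (n + 1), add_sub_cancel_right]
  rw [e₁, e₂] at h₁ h₃
  rw [e₃, e₄] at h₃
  refine ⟨h₁, (((hd.pow 2).mul h₃).div hc hc₀).congr ?_ rfl⟩
  have hc' := hc.ne_zero hc₀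
  have h₀ := h₃.ne_zero (chordValue_ne_zero _ _)
  simp only [normalizedDivFun, divFun] at hc' ⊢
  rw [show xCoord (genericPoint W) = xFun W from rfl] at h₀ ⊢
  have k₁ := (div_ne_zero_iff.mp hc').2
  have k₄ := right_ne_zero_of_mul (div_ne_zero_iff.mp h₀).1
  have k₆ := right_ne_zero_of_mul (left_ne_zero_of_mul (div_ne_zero_iff.mp h₀).1)
  generalize localParam (genericPoint W) Q = s at *
  generalize localParam ((n + 1) • genericPoint W) ((n + 1) • Q) = t₁ at *
  generalize localParam ((n + 2) • genericPoint W) ((n + 2) • Q) = t₂ at *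
  generalize localParam ((n + 3) • genericPoint W) ((n + 3) • Q) = t₃ at *
  have k₇ : s ≠ 0 := (pow_ne_zero_iff two_ne_zero).mp k₆
  have k₈ : t₂ ≠ 0 := (pow_ne_zero_iff two_ne_zero).mp k₄
  -- The parallelogram law `(n+3)² + (n+1)² = 2(n+2)² + 2` makes the powers of the local parameter
  -- at `Q` cancel.
  have : s ^ (n + 3) ^ 2 * s ^ (n + 1) ^ 2 = (s ^ (n + 2) ^ 2) ^ 2 * s ^ 2 := by
    rw [← pow_mul, ← pow_add, ← pow_add]
    congr 1
    ring
  field_simp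
  linear_combination -this

lemma DivFunRegularAt.step {n : ℕ} {Q : (W.baseChange L).Point}
    (hx : xFun W ≠ xCoord ((n + 2) • genericPoint W)) (h : DivFunRegularAt W (n + 1) Q)
    (h' : DivFunRegularAt W (n + 2) Q) : DivFunRegularAt W (n + 3) Q := by
  obtain ⟨-, c, hc₀, hc₁, hc⟩ := h
  obtain ⟨hn, d, hd₀, hd₁, hd⟩ := h'
  obtain ⟨h₁, h₂⟩ := normalizedDivFun_hasValue hn hx hc₀ hc hd
  refine ⟨h₁, _, div_ne_zero (mul_ne_zero (pow_ne_zero 2 hd₀) (chordValue_ne_zero _ _)) hc₀,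
    ?_, h₂⟩
  rintro rfl
  rw [hc₁ rfl, hd₁ rfl]
  simp [chordValue]

end Generic

/-! ### The multiples of the generic point are distinct from its negative -/

section MultiplesOfGenericPoint

variable {K : Type*} [Field K] {W : Affine K} [W.IsElliptic] [DecidableEq W.FunctionField]

/-- If `[n] = [-1]` on the generic point, reduction gives `nQ = -Q` for every `Q`; then `divFun W n`
has no affine zeros or poles and is a constant `c`. At `𝓞` the normalized function is `c` times
`z^(n²-1)` times a unit, which vanishes since `n ≥ 2`, against regularity. -/
lemma nsmul_genericPoint_ne_neg {n : ℕ} (hn : 2 ≤ n) [DecidableEq (AlgebraicClosure K)]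
    (h : ∀ Q : (W.baseChange (AlgebraicClosure K)).Point, DivFunRegularAt W n Q) :
    n • genericPoint W ≠ -genericPoint W := by
  intro hng
  have hneg (Q : (W.baseChange (AlgebraicClosure K)).Point) : n • Q = -Q :=
    (h Q).1.unique <| hng ▸ reduces_neg (curveReduces_baseChange _ W) (reduces_genericPoint W Q)
  obtain ⟨-, e, he₀, -, he⟩ := h 0
  have he' := he.ne_zero he₀
  simp only [normalizedDivFun] at he he'
  rw [hng, smul_zero, localParam_zero, localParam_zero] at he he'
  obtain ⟨c, hc⟩ := exists_eq_const_of_units (f := divFun W n)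
    (left_ne_zero_of_mul (div_ne_zero_iff.mp he').1) fun Q hQ => by
      obtain ⟨-, e, he₀, -, he⟩ := h Q
      refine ⟨e, he₀, ?_⟩
      rwa [normalizedDivFun, hneg, localParam_of_ne_zero _ hQ,
        localParam_of_ne_zero _ (neg_ne_zero.mpr hQ), one_pow, mul_one, div_one] at he
  obtain ⟨k, hk⟩ : ∃ k, n ^ 2 = k + 2 := ⟨n ^ 2 - 2, by have := Nat.pow_le_pow_left hn 2; omega⟩
  have hz : (pointRel W (0 : (W.baseChange (AlgebraicClosure K)).Point)).HasValue (zFun W) 0 :=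
    chartRel_fst ..
  have hw : (pointRel W (0 : (W.baseChange (AlgebraicClosure K)).Point)).HasValue (wFun W) 0 :=
    chartRel_snd ..
  have hu := (((((pointRel W _).const W.a₁).mul hz).add
    (((pointRel W _).const W.a₃).mul hw)).sub (pointRel W _).one)
  have := ((((pointRel W _).const c).mul (hz.pow (k + 1))).mul hu).unique
    (he.congr (g := algebraMap K _ c * zFun W ^ (k + 1) * (algebraMap K _ W.a₁ * zFun W +
      algebraMap K _ W.a₃ * wFun W - 1)) ?_ rfl)
  · simp at this
    exact he₀ this.symm
  · have hzn : zCoord (-genericPoint W) = -(xFun W /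
      (-yFun W - algebraMap K _ W.a₁ * xFun W - algebraMap K _ W.a₃)) := rfl
    have hzg : zCoord (genericPoint W) = zFun W := rfl
    have h₁ := (div_ne_zero_iff.mp he').2
    rw [hzn, neg_ne_zero] at h₁
    have h₃ := xFun_ne_zero (W := W)
    have h₄ := yFun_ne_zero (W := W)
    rw [hzn, hzg, hk, hc, pow_succ _ (k + 1)]
    generalize zFun W ^ (k + 1) = s
    rw [zFun, wFun]
    field_simp
    ring

/-- Regularity and the nonvanishing of `x - x∘[n]` need each other, hence one induction. Equal
`x`-coordinates would make `(n+2)` times the generic point equal to plus or minus it: the first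
contradicts `Reduces.ne_zero` for `n + 1`, the second `nsmul_genericPoint_ne_neg`. -/
lemma xFun_ne_xCoord_nsmul_genericPoint_aux (n : ℕ) [DecidableEq (AlgebraicClosure K)] :
    xFun W ≠ xCoord ((n + 2) • genericPoint W) ∧
    (∀ Q : (W.baseChange (AlgebraicClosure K)).Point, DivFunRegularAt W (n + 1) Q) ∧
    (∀ Q : (W.baseChange (AlgebraicClosure K)).Point, DivFunRegularAt W (n + 2) Q) := by
  have key (n : ℕ)
      (h₁ : ∀ Q : (W.baseChange (AlgebraicClosure K)).Point, DivFunRegularAt W (n + 1) Q)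
      (h₂ : ∀ Q : (W.baseChange (AlgebraicClosure K)).Point, DivFunRegularAt W (n + 2) Q) :
      xFun W ≠ xCoord ((n + 2) • genericPoint W) := by
    intro hx
    have hn := nsmul_genericPoint_ne_neg (by omega) h₂
    have h₀ := (h₁ 0).1.ne_zero
    have h₀' := (h₂ 0).1.ne_zero
    have hs : (n + 2) • genericPoint W ≠ genericPoint W := by
      rwa [succ_nsmul, Ne, add_eq_right]
    rcases h : (n + 2) • genericPoint W with _ | ⟨x, y, h'⟩
    · exact h₀' h
    rw [h] at hx hn hs
    rcases Affine.Point.X_eq_iff.mp hx with h | h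
    · exact hs h.symm
    · exact hn (neg_eq_iff_eq_neg.mpr h).symm
  induction n with
  | zero => exact ⟨key 0 divFunRegularAt_one divFunRegularAt_two, divFunRegularAt_one,
      divFunRegularAt_two⟩
  | succ n ih =>
    have h₃ := fun Q => (ih.2.1 Q).step ih.1 (ih.2.2 Q)
    exact ⟨key (n + 1) ih.2.2 h₃, ih.2.2, h₃⟩

lemma xFun_ne_xCoord_nsmul_genericPoint (n : ℕ) :
    xFun W ≠ xCoord ((n + 2) • genericPoint W) := by
  classical exact (xFun_ne_xCoord_nsmul_genericPoint_aux n).1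

theorem divFunRegularAt {L : Type*} [Field L] [Algebra K L] [DecidableEq L] (n : ℕ)
    (Q : (W.baseChange L).Point) : DivFunRegularAt W (n + 1) Q := by
  suffices DivFunRegularAt W (n + 1) Q ∧ DivFunRegularAt W (n + 2) Q from this.1
  induction n with
  | zero => exact ⟨divFunRegularAt_one Q, divFunRegularAt_two Q⟩
  | succ n ih => exact ⟨ih.2, ih.1.step (xFun_ne_xCoord_nsmul_genericPoint n) ih.2⟩

end MultiplesOfGenericPoint

/-! ### Identification with the normalized division polynomials -/

section Uniqueness

variable {K : Type*} [Field K] {W : Affine K} [W.IsElliptic]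

/-- The quotient of two candidates is a unit at all affine points, hence constant, and the
normalization at `𝓞` makes it `1`. -/
lemma IsDivisionPolynomial.unique {n : ℕ} {F F' : W.FunctionField}
    (h : IsDivisionPolynomial W n F) (h' : IsDivisionPolynomial W n F') : F = F' := by
  obtain ⟨h₁, h₂⟩ := h
  obtain ⟨h₁', h₂'⟩ := h'
  replace h₂ := (pointRel_hasValue W (L := K) .zero _ _).mpr h₂
  replace h₂' := (pointRel_hasValue W (L := K) .zero _ _).mpr h₂'
  have k := h₂.ne_zero one_ne_zero
  have k' := h₂'.ne_zero one_ne_zero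
  have hF := right_ne_zero_of_mul (div_ne_zero_iff.mp k).1
  have hF' := right_ne_zero_of_mul (div_ne_zero_iff.mp k').1
  have hz := left_ne_zero_of_mul (div_ne_zero_iff.mp k).1
  have ht := (div_ne_zero_iff.mp k).2
  obtain ⟨c, hc⟩ := exists_eq_const_of_units (div_ne_zero hF hF') fun Q _ => by
    obtain ⟨c, hc₀, hc⟩ := h₁ Q
    obtain ⟨c', hc₀', hc'⟩ := h₁' Q
    rw [← pointRel_hasValue] at hc hc'
    refine ⟨_, div_ne_zero hc₀ hc₀', (hc.div hc' hc₀').congr ?_ rfl⟩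
    exact div_div_div_cancel_right₀ (div_ne_zero_iff.mp (hc.ne_zero hc₀)).2 _ _
  have := ((pointRel W (L := K) .zero).const c).unique
    ((h₂.div h₂' one_ne_zero).congr (by rw [← hc]; field_simp) (div_one 1))
  rw [show c = 1 from this, map_one, div_eq_one_iff_eq hF'] at hc
  exact hc

open Classical in
theorem isDivisionPolynomial_divFun {n : ℕ} (hn : n ≠ 0) :
    IsDivisionPolynomial W n (divFun W n) := by
  obtain ⟨n, rfl⟩ := Nat.exists_eq_succ_of_ne_zero hn
  constructor
  · intro Q
    obtain ⟨-, e, he₀, -, he⟩ := divFunRegularAt n Q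
    refine ⟨e, he₀, ?_⟩
    rw [← pointRel_hasValue]
    refine he.congr ?_ rfl
    rw [normalizedDivFun, localEquation, div_div_eq_mul_div]
    rfl
  · obtain ⟨-, e, -, he₁, he⟩ := divFunRegularAt n (0 : (W.baseChange K).Point)
    rw [← Affine.Point.zero_def, ← pointRel_hasValue]
    refine he.congr ?_ (he₁ rfl)
    rw [normalizedDivFun, smul_zero, localParam_zero, localParam_zero, mul_comm]
    rfl

open Classical in
theorem divisionPolynomial_eq_divFun (n : ℕ) : divisionPolynomial W n = divFun W n := by
  rcases eq_or_ne n 0 with rfl | hn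
  · rfl
  rw [divisionPolynomial, if_neg hn]
  have := isDivisionPolynomial_divFun (W := W) hn
  exact (Classical.epsilon_spec (p := IsDivisionPolynomial W n) ⟨_, this⟩).unique this

end Uniqueness

/-! ### Sequences with `ε (n + 2) ε n = ε (n + 1)² u (n + 2)` and periodic `u` -/

section Sequence

variable {K : Type*} [Field K]

/-- The indices `m + 2, …, 2m + 2` mirror `1, …, m + 1`, with one sign change, at the pair `1, 2m +
2`; it is compensated by `u 0 = -1`. -/
lemma isSquare_prod_range {u : ℕ → K} {m : ℕ} (h₀ : u 0 = -1) (h₁ : u (2 * m + 2) = -u 1)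
    (hu : ∀ i, 2 ≤ i → i ≤ m + 1 → u (2 * m + 3 - i) = u i) :
    IsSquare (∏ i ∈ Finset.range (2 * m + 3), u i) := by
  refine ⟨∏ i ∈ Finset.range (m + 1), u (i + 1), ?_⟩
  have h : ∏ i ∈ Finset.range (m + 1), u (m + 1 + i + 1) =
      -∏ i ∈ Finset.range (m + 1), u (i + 1) := by
    rw [← Finset.prod_range_reflect, Finset.prod_range_succ', Finset.prod_range_succ', ← mul_neg]
    congr 1
    · refine Finset.prod_congr rfl fun i hi => ?_
      have := Finset.mem_range.mp hi
      rw [← hu (i + 1 + 1) (by omega) (by omega)]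
      congr 1
      omega
    · rw [← h₁]
      congr 1
      omega
  rw [Finset.prod_range_succ', show 2 * m + 2 = m + 1 + (m + 1) by ring, Finset.prod_range_add, h,
    h₀]
  ring

variable {ε u : ℕ → K} {r : ℕ} (hε : ∀ n, ε n ≠ 0)
  (hrec : ∀ n, ε (n + 2) * ε n = ε (n + 1) ^ 2 * u (n + 2)) (hu₀ : ∀ n, u n ≠ 0)
  (hu : ∀ n, u (n + r) = u n)

include hu₀ hu in
lemma prod_range_shift (n : ℕ) :
    ∏ i ∈ Finset.range r, u (n + i) = ∏ i ∈ Finset.range r, u i := by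
  induction n with
  | zero => simp
  | succ n ih =>
    rw [← ih]
    have h₁ := Finset.prod_range_succ (fun i => u (n + i)) r
    rw [Finset.prod_range_succ', hu, add_zero] at h₁
    rw [← mul_right_cancel₀ (hu₀ n) h₁]
    exact Finset.prod_congr rfl fun i _ => by rw [add_assoc, add_comm 1]

include hε in
lemma div_eq_prod_ratio (n k : ℕ) :
    ε (n + k) / ε n = ∏ i ∈ Finset.range k, (ε (n + i + 1) / ε (n + i)) := by
  induction k with
  | zero => simp [hε]
  | succ k ih =>
    rw [Finset.prod_range_succ, ← ih, ← add_assoc]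
    have := hε (n + k)
    field_simp

include hε hrec in
lemma ratio_add (n k : ℕ) : ε (n + k + 1) / ε (n + k) =
    (∏ i ∈ Finset.range k, u (n + 2 + i)) * (ε (n + 1) / ε n) := by
  induction k with
  | zero => simp
  | succ k ih =>
    rw [Finset.prod_range_succ, mul_right_comm, ← ih]
    have h₀ := hε (n + k)
    have h₁ := hε (n + k + 1)
    have := hrec (n + k)
    rw [show n + 2 + k = n + k + 2 by ring, ← add_assoc]
    field_simp
    linear_combination this

include hε hrec hu₀ hu

/-- Each of the `r` consecutive ratios making up `ε (n + r) / ε n` is multiplied by the product of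
`u` over a period. -/
lemma div_add_period (n : ℕ) : ε (n + r + r) / ε (n + r) =
    (∏ i ∈ Finset.range r, u i) ^ r * (ε (n + r) / ε n) := by
  rw [div_eq_prod_ratio hε (n + r), div_eq_prod_ratio hε n, ← Finset.card_range r,
    ← Finset.prod_const, Finset.card_range, ← Finset.prod_mul_distrib]
  refine Finset.prod_congr rfl fun i _ => ?_
  rw [add_right_comm n r i, ratio_add hε hrec, prod_range_shift hu₀ hu]

lemma add_mul_period (n k : ℕ) : ε (n + r * k) =
    ε n * (ε (n + r) / ε n) ^ k * ((∏ i ∈ Finset.range r, u i) ^ r) ^ k.choose 2 := by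
  set a := (∏ i ∈ Finset.range r, u i) ^ r
  have h (k : ℕ) : ε (n + r * (k + 1)) / ε (n + r * k) = a ^ k * (ε (n + r) / ε n) := by
    induction k with
    | zero => simp
    | succ k ih =>
      rw [pow_succ', mul_assoc, ← ih, mul_add_one r (k + 1), mul_add_one r k,
        ← add_assoc, ← add_assoc]
      exact div_add_period hε hrec hu₀ hu (n + r * k)
  induction k with
  | zero => simp
  | succ k ih =>
    rw [← div_mul_cancel₀ (ε (n + r * (k + 1))) (hε (n + r * k)), h, ih, Nat.choose_succ_succ' k 1,
      Nat.choose_one_right, pow_add, pow_succ]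
    ring

/-- Put `k = q - 1` in `add_mul_period`. Since `k` need not divide `k(k-1)/2`, squareness is needed:
`(b²)^(k(k-1)/2) = (b^k)^(k-1) = 1`. -/
theorem add_period_mul_card_sub_one [Fintype K]
    (ha : IsSquare ((∏ i ∈ Finset.range r, u i) ^ r)) (n : ℕ) :
    ε (n + r * (Fintype.card K - 1)) = ε n := by
  have ha₀ : (∏ i ∈ Finset.range r, u i) ^ r ≠ 0 :=
    pow_ne_zero _ (Finset.prod_ne_zero_iff.mpr fun i _ => hu₀ i)
  rw [add_mul_period hε hrec hu₀ hu,
    FiniteField.pow_card_sub_one_eq_one _ (div_ne_zero (hε _) (hε _))]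
  obtain ⟨b, hb⟩ := ha
  rw [hb] at ha₀ ⊢
  rw [← sq, ← pow_mul, Nat.choose_two_right, Nat.mul_div_cancel' (Nat.even_mul_pred_self _).two_dvd,
    pow_mul, FiniteField.pow_card_sub_one_eq_one _ (left_ne_zero_of_mul ha₀), one_pow, mul_one,
    mul_one]

end Sequence

/-! ### Least periods -/

section Period

lemma exists_hasLeastPeriod {α : Type*} {s : ℕ → α} {m : ℕ} (hm : 0 < m)
    (h : ∀ n, s (n + m) = s n) : ∃ l, HasLeastPeriod s l ∧ l ∣ m := by
  classical
  have hex : ∃ l, 0 < l ∧ ∀ n, s (n + l) = s n := ⟨m, hm, h⟩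
  obtain ⟨hl, hp⟩ := Nat.find_spec hex
  refine ⟨Nat.find hex, ⟨⟨hl, hp⟩, fun k hk => Nat.find_le hk⟩, ?_⟩
  have hp' (n k : ℕ) : s (n + Nat.find hex * k) = s n := by
    induction k with
    | zero => rfl
    | succ k ih => rw [mul_add_one, ← add_assoc, hp, ih]
  by_contra hd
  refine Nat.find_min hex (Nat.mod_lt m hl) ⟨Nat.pos_of_ne_zero (mt Nat.dvd_of_mod_eq_zero hd),
    fun n => ?_⟩
  rw [← hp' _ (m / Nat.find hex), add_assoc, Nat.mod_add_div, h]

end Period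

/-! ### Values at a rational point of finite order -/

section Values

variable {K : Type*} [Field K] (W : Affine K)

lemma valueAt_eq_of_hasValue {f : W.FunctionField} {c : K} (Q : (W.baseChange K).Point)
    (h : (pointRel W Q).HasValue f c) : valueAt W f Q = c := by
  have h' := Classical.epsilon_spec (p := (pointRel W Q).HasValue f) ⟨c, h⟩
  rw [← h'.unique h]
  cases Q <;> rfl

variable {W} [DecidableEq K]

/-- For odd `r`, `(r - i)Q = -iQ` and `chordValue Q` is even, except at `±Q` where it changes sign,
and it is `-1` at `0`: this is the pattern of `isSquare_prod_range`. -/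
lemma isSquare_prod_chordValue {Q : (W.baseChange K).Point} {r : ℕ} (hr : 2 ≤ r)
    (hQr : addOrderOf Q = r) :
    IsSquare ((∏ i ∈ Finset.range r, chordValue Q (i • Q)) ^ r) := by
  rcases Nat.even_or_odd r with h | ⟨m, hm⟩
  · exact h.isSquare_pow _
  refine IsSquare.pow _ ?_
  have hdvd (n : ℕ) : n • Q = 0 ↔ r ∣ n := hQr ▸ addOrderOf_dvd_iff_nsmul_eq_zero.symm
  have hQ : Q ≠ 0 := by
    rw [← one_nsmul Q, Ne, hdvd]
    exact Nat.not_dvd_of_pos_of_lt one_pos (by omega)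
  have hneg (i : ℕ) (hi : i ≤ r) : (r - i) • Q = -(i • Q) := by
    rw [eq_neg_iff_add_eq_zero, ← add_nsmul, Nat.sub_add_cancel hi, hdvd]
  obtain ⟨m, rfl⟩ : ∃ k, m = k + 1 := ⟨m - 1, by omega⟩
  obtain rfl : r = 2 * m + 3 := by omega
  refine isSquare_prod_range ?_ ?_ fun i hi hi' => ?_
  · rw [zero_smul, chordValue_zero hQ]
  · have := hneg 1 (by omega)
    rw [one_nsmul] at this
    rw [show 2 * m + 2 = 2 * m + 3 - 1 by omega, this, one_nsmul]
    refine chordValue_neg_self hQ fun h => ?_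
    rw [eq_neg_iff_add_eq_zero, ← two_nsmul, hdvd] at h
    exact Nat.not_dvd_of_pos_of_lt two_pos (by omega) h
  · rw [hneg i (by omega)]
    obtain ⟨i, rfl⟩ : ∃ k, i = k + 1 := ⟨i - 1, by omega⟩
    refine chordValue_neg (fun h => ?_) fun h => ?_
    · rw [succ_nsmul, add_eq_right, hdvd] at h
      exact Nat.not_dvd_of_pos_of_lt (by omega) (by omega) h
    · rw [eq_neg_iff_add_eq_zero, ← succ_nsmul, hdvd] at h
      exact Nat.not_dvd_of_pos_of_lt (by omega) (by omega) h

variable [W.IsElliptic] [DecidableEq W.FunctionField]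

lemma divFun_hasValue {n : ℕ} {Q : (W.baseChange K).Point} (hQ : Q ≠ 0) (hnQ : n • Q ≠ 0) {e : K}
    (he : (pointRel W Q).HasValue (normalizedDivFun W n Q) e) :
    (pointRel W Q).HasValue (divFun W n) e := by
  rwa [normalizedDivFun, localParam_of_ne_zero _ hQ, localParam_of_ne_zero _ hnQ, one_pow, mul_one,
    div_one] at he

lemma divFun_hasValue_zero {n : ℕ} {Q : (W.baseChange K).Point} (hQ : Q ≠ 0) (hnQ : n • Q = 0) :
    (pointRel W Q).HasValue (divFun W n) 0 := by
  rcases n with _ | n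
  · exact (pointRel W Q).zero
  obtain ⟨hr, e, he₀, -, he⟩ := divFunRegularAt n Q
  have he' := he.ne_zero he₀
  rw [normalizedDivFun, localParam_of_ne_zero _ hQ, hnQ, localParam_zero, one_pow, mul_one]
    at he he'
  rw [hnQ] at hr
  have hz : (pointRel W Q).HasValue (zCoord ((n + 1) • genericPoint W)) 0 := by
    rcases h : (n + 1) • genericPoint W with _ | ⟨x, y, h'⟩
    · exact (hr.ne_zero h).elim
    · rw [h] at hr
      exact hr.2.1
  refine (he.mul hz).congr (div_mul_cancel₀ _ (div_ne_zero_iff.mp he').2) (mul_zero e)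

/-- The index is shifted: `ε n` belongs to `F_{n+1}`. It is a normalized value, so it stays nonzero
even where `F_{n+1}` vanishes at `Q`, and the recursion holds without exception. -/
theorem exists_divFun_values {Q : (W.baseChange K).Point} (hQ : Q ≠ 0) : ∃ ε : ℕ → K,
    (∀ n, ε n ≠ 0) ∧ (∀ n, ε (n + 2) * ε n = ε (n + 1) ^ 2 * chordValue Q ((n + 2) • Q)) ∧
    ∀ n, (n + 1) • Q ≠ 0 → (pointRel W Q).HasValue (divFun W (n + 1)) (ε n) := by
  choose ε hε₀ _ hε using fun n => (divFunRegularAt n Q).2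
  refine ⟨ε, hε₀, fun n => ?_, fun n hn => divFun_hasValue hQ hn (hε n)⟩
  have := (normalizedDivFun_hasValue (divFunRegularAt (n + 1) Q).1
    (xFun_ne_xCoord_nsmul_genericPoint n) (hε₀ n) (hε n) (hε (n + 1))).2
  rw [(hε (n + 2)).unique this, div_mul_cancel₀ _ (hε₀ n)]

end Values

theorem exists_hasLeastPeriod_divisionPolynomial {K : Type*} [Field K] [Fintype K] [DecidableEq K]
    {W : Affine K} [W.IsElliptic] (Q : (W.baseChange K).Point) {r : ℕ} (hr : 2 ≤ r)
    (hQr : addOrderOf Q = r) :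
    ∃ t : ℕ, HasLeastPeriod (fun n => valueAt W (divisionPolynomial W n) Q) (r * t) ∧
      t ∣ Fintype.card K - 1 := by
  classical
  have hdvd (n : ℕ) : n • Q = 0 ↔ r ∣ n := hQr ▸ addOrderOf_dvd_iff_nsmul_eq_zero.symm
  have hQ : Q ≠ 0 := by
    rw [← one_nsmul Q, Ne, hdvd]
    exact Nat.not_dvd_of_pos_of_lt one_pos (by omega)
  obtain ⟨ε, hε₀, hrec, hε⟩ := exists_divFun_values hQ
  have hper (n : ℕ) : ε (n + r * (Fintype.card K - 1)) = ε n :=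
    add_period_mul_card_sub_one (u := fun i => chordValue Q (i • Q)) hε₀ hrec
      (fun _ => chordValue_ne_zero _ _)
      (fun n => by rw [add_nsmul, (hdvd r).mpr dvd_rfl, add_zero])
      (isSquare_prod_chordValue hr hQr) n
  set s : ℕ → K := fun n => valueAt W (divisionPolynomial W n) Q
  have hs₀ (n : ℕ) (hn : r ∣ n) : s n = 0 := by
    refine valueAt_eq_of_hasValue W Q ?_
    rw [divisionPolynomial_eq_divFun]
    convert divFun_hasValue_zero hQ ((hdvd n).mpr hn)
  have hs (n : ℕ) (hn : ¬r ∣ n + 1) : s (n + 1) = ε n := by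
    refine valueAt_eq_of_hasValue W Q ?_
    rw [divisionPolynomial_eq_divFun]
    convert hε n (mt (hdvd _).mp hn)
  have hq : 0 < Fintype.card K - 1 := Nat.sub_pos_of_lt Fintype.one_lt_card
  obtain ⟨l, hl, hlr⟩ := exists_hasLeastPeriod (s := s) (m := r * (Fintype.card K - 1))
    (Nat.mul_pos (by omega) hq) fun n => by
      by_cases hn : r ∣ n
      · rw [hs₀ n hn, hs₀ _ (hn.add (dvd_mul_right ..))]
      · obtain ⟨n, rfl⟩ := Nat.exists_eq_succ_of_ne_zero (n := n) (by rintro rfl; simp at hn)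
        rw [Nat.succ_eq_add_one] at hn ⊢
        rw [add_right_comm, hs n hn, hs, hper]
        rwa [add_right_comm, Nat.dvd_add_left (dvd_mul_right ..)]
  -- A period `l` gives `s l = s 0 = 0`, whereas `s` is nonzero off the multiples of `r`.
  obtain ⟨t, rfl⟩ : r ∣ l := by
    by_contra h
    obtain ⟨k, rfl⟩ := Nat.exists_eq_succ_of_ne_zero (n := l) (by rintro rfl; simp at h)
    refine hε₀ k ?_
    rw [← hs k h, ← hs₀ 0 (dvd_zero r), ← hl.1.2 0, zero_add]
  exact ⟨t, hl, Nat.dvd_of_mul_dvd_mul_left (by omega) hlr⟩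

end DivisionPolynomial

open DivisionPolynomial in
theorem corollary9 {𝔽 : Type*} [Field 𝔽] [Fintype 𝔽] [DecidableEq 𝔽]
    (E : WeierstrassCurve.Affine 𝔽) [E.IsElliptic] (P : E.Point) (r : ℕ) (hr : 2 ≤ r)
    (hP : addOrderOf P = r) :
    ∃ t : ℕ, HasLeastPeriod (fun n => valueAt E (divisionPolynomial E n) P) (r * t) ∧
      (3 ≤ r → t ∣ Fintype.card 𝔽 - 1) ∧ (r = 2 → t ∣ 2 * Fintype.card 𝔽 - 2) := by
  -- `P` is read as a point of the base change of `E` to `𝔽` itself, which is `E` by definition. The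
  -- divisibility obtained is `t ∣ q - 1` for every `r ≥ 2`.
  obtain ⟨t, ht, hd⟩ := exists_hasLeastPeriod_divisionPolynomial (W := E) P hr hP
  refine ⟨t, ht, fun _ => hd, fun _ => ?_⟩
  rw [show 2 * Fintype.card 𝔽 - 2 = 2 * (Fintype.card 𝔽 - 1) by omega]
  exact hd.mul_left 2
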